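/- **Proposition 3.6.** Let $k$ be a finite field with $q$ elements, $v=\sqrt q\in\mathbb C$, and let $\mathcal A$ be a (small) $k$-linear abelian category with enough projectives, of finite global dimension, all of whose Hom- and Ext-spaces are finite dimensional over $k$. Let $\mathcal P\subset\mathcal A$ be the full subcategory of projective objects, $K(\mathcal A)$ the Grothendieck group, $\hat M$ the class of $M$ in $K(\mathcal A)$, and $\langle \hat M,\hat N\rangle=\sum_{i\ge 0}(-1)^i\dim_k\operatorname{Ext}^i_{\mathcal A}(M,N)$ the Euler form. *Hall algebras.* For objects $L,M,N$ of an abelian category let $\operatorname{Ext}^1(M,N)_L$ be the set of equivalence classes of short exact sequences $0\to N\to L\to M\to 0$ with middle term $L$. The Ringel–Hall algebra $\mathcal H_{\rm tw}(\mathcal A)$ is the $\mathbb C$-vector space with basis the isomorphism classes $[M]\in\operatorname{Iso}(\mathcal A)$ and product $$[M]*[N]=v^{\langle\hat M,\hat N\rangle}\sum_{[L]}\frac{|\operatorname{Ext}^1_{\mathcal A}(M,N)_L|}{|\operatorname{Hom}_{\mathcal A}(M,N)|}[L].$$ Let $\mathcal C_2(\mathcal A)$ be the abelian category of 2-cyclic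 complexes $M_\bullet=(d_1\colon M_1\rightleftarrows M_0\colon d_0)$, $d_0d_1=0=d_1d_0$, and $\mathcal C_2(\mathcal P)$ its full subcategory of complexes of projectives. The algebra $\mathcal H_{\rm tw}(\mathcal C_2(\mathcal P))$ has as $\mathbb C$-basis the isomorphism classes $[M_\bullet]$ of objects of $\mathcal C_2(\mathcal P)$, and product $$[M_\bullet]*[N_\bullet]=v^{\langle\hat M_0,\hat N_0\rangle+\langle\hat M_1,\hat N_1\rangle}\sum_{[L_\bullet]}\frac{|\operatorname{Ext}^1_{\mathcal C_2(\mathcal A)}(M_\bullet,N_\bullet)_{L_\bullet}|}{|\operatorname{Hom}_{\mathcal C_2(\mathcal A)}(M_\bullet,N_\bullet)|}[L_\bullet].$$ Bridgeland's Hall algebra $\mathcal{DH}_2(\mathcal A)$ is the localization of $\mathcal H_{\rm tw}(\mathcal C_2(\mathcal P))$ at the classes $[M_\bullet]$ of acyclic complexes. For $P\in\mathcal P$ let $K_P$ (resp. $K_P^*$) be the acyclic complex with $P$ in both degrees and $d_1=1,\ d_0=0$ (resp. $d_1=0,\ d_0=1$). For $\alpha=\hat P-\hat Q\in K(\mathcal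 A)$ with $P,Q\in\mathcal P$ put $K_\alpha=[K_P]*[K_Q]^{-1}$ and $K^*_\alpha=[K^*_P]*[K^*_Q]^{-1}$ in $\mathcal{DH}_2(\mathcal A)$. *The elements $E_M$.* Every $M\in\mathcal A$ has a finite projective resolution $0\to P_n\xrightarrow{p_n}\cdots\xrightarrow{p_1}P_0\to M\to0$. Given one, put $M_i=\operatorname{Im}p_i$ for $1\le i\le n$, let $M_{\rm odd}$ and $M_{\rm even}$ be the direct sums of the $M_i$ with $1\le i\le n$ odd, respectively even, let $C_M=\big(\bigoplus_{i\text{ odd}}P_i\rightleftarrows\bigoplus_{i\text{ even}}P_i\big)$ be the 2-cyclic complex whose differentials are formed by the $p_i$, and put $$E_M=v^{\langle\hat M_{\rm odd}-\hat M_{\rm even},\hat M\rangle}\,K_{-\hat M_{\rm odd}}*K^*_{-\hat M_{\rm even}}*[C_M]\in\mathcal{DH}_2(\mathcal A).$$ *Claim.* For every choice of finite projective resolutions, one for each object of $\mathcal A$, the $\mathbb C$-linear map $$\varphi\colon\mathcal H_{\rm tw}(\mathcal A)\to\mathcal{DH}_2(\mathcal A),\qquad [M]\mapsto E_M,$$ is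 injective; that is, the elements $E_M$, with $M$ running over representatives of the isomorphism classes of objects of $\mathcal A$, are linearly independent in $\mathcal{DH}_2(\mathcal A)$. -/

import Mathlib

open CategoryTheory CategoryTheory.Limits

noncomputable section

namespace BridgelandHall

universe u v

attribute [local instance] Abelian.hasFiniteBiproducts

/-! ### Isomorphism classes, Hall numbers, Euler form -/

/-- The set `Iso(D)` of isomorphism classes of objects of a category `D`. -/
abbrev IsoClass (D : Type u) [Category.{v} D] : Type u := Quotient (isIsomorphicSetoid D)

/-- The isomorphism class `[X]`. -/
abbrev isoClass {D : Type u} [Category.{v} D] (X : D) : IsoClass D :=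
  Quotient.mk (isIsomorphicSetoid D) X

section Hall

variable {D : Type u} [Category.{v} D] [HasZeroMorphisms D]

/-- Short exact sequences `0 ⟶ N ⟶ L ⟶ M ⟶ 0` with given middle term `L`. -/
def Extension (M N L : D) : Type v :=
  {ip : (N ⟶ L) × (L ⟶ M) // ∃ w : ip.1 ≫ ip.2 = 0, (ShortComplex.mk ip.1 ip.2 w).ShortExact}

/-- Equivalence of extensions: an isomorphism of middle terms inducing the identity on `N`
and on `M`. -/
def extensionSetoid (M N L : D) : Setoid (Extension M N L) where
  r a b := ∃ g : L ≅ L, a.1.1 ≫ g.hom = b.1.1 ∧ g.hom ≫ b.1.2 = a.1.2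
  iseqv :=
    { refl := fun a => ⟨Iso.refl L, by simp, by simp⟩
      symm := by
        rintro a b ⟨g, h₁, h₂⟩
        exact ⟨g.symm, by simp [← h₁], by simp [← h₂]⟩
      trans := by
        rintro a b c ⟨g, h₁, h₂⟩ ⟨g', h₃, h₄⟩
        exact ⟨g.trans g', by simp [← h₃, ← h₁], by simp [h₄, h₂]⟩ }

/-- `Ext¹(M, N)_L`: the equivalence classes of short exact sequences
`0 ⟶ N ⟶ L ⟶ M ⟶ 0` with middle term `L`. -/
def ExtMiddle (M N L : D) : Type v := Quotient (extensionSetoid M N L)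

/-- The structure constant `|Ext¹(M, N)_L| / |Hom(M, N)|` of the Hall algebra. -/
def hallNumber (M N L : D) : ℂ := (Nat.card (ExtMiddle M N L) : ℂ) / (Nat.card (M ⟶ N) : ℂ)

/-- The product of basis vectors `[M] * [N] = t(M, N) ∑_{[L]} |Ext¹(M, N)_L| / |Hom(M, N)| [L]`
twisted by a scalar `t`, where the basis is indexed by `I` and `ob c` is an object representing
`c : I`. The sum is finite in the cases considered below. -/
def twistedHallProduct {I : Type*} (ob : I → D) (t : D → D → ℂ) (a b : I) : I →₀ ℂ :=
  ∑ᶠ c : I, Finsupp.single c (t (ob a) (ob b) * hallNumber (ob a) (ob b) (ob c))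

end Hall

/-- The number `v = √q`, where `q = |k|`. -/
def vParam (k : Type*) : ℂ := ((Real.sqrt (Nat.card k) : ℝ) : ℂ)

section Abelian

variable (k : Type*) [Field k] {𝒜 : Type u} [Category.{v} 𝒜] [Abelian 𝒜] [Linear k 𝒜]

/-- `dim_k Extⁱ(X, Y)`. -/
def extDim (X Y : 𝒜) (i : ℕ) : ℕ :=
  letI := HasExt.standard 𝒜
  Module.finrank k (Abelian.Ext.{max u v} X Y i)

/-- The Euler form `⟨X, Y⟩ = ∑ᵢ (-1)ⁱ dim_k Extⁱ(X, Y)`; the sum is finite when the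
global dimension is finite. -/
def eulerForm (X Y : 𝒜) : ℤ := ∑ᶠ i : ℕ, (-1 : ℤ) ^ i * (extDim k X Y i : ℤ)

variable (𝒜)

/-- `𝒜` is finitary over `k`: all Hom-spaces and all Ext-spaces are finite dimensional. -/
structure IsFinitary : Prop where
  finite_hom : ∀ X Y : 𝒜, Module.Finite k (X ⟶ Y)
  finite_ext : ∀ (X Y : 𝒜) (i : ℕ),
    letI := HasExt.standard 𝒜
    Module.Finite k (Abelian.Ext.{max u v} X Y i)

/-- `𝒜` has finite global dimension. -/
def HasFiniteGlobalDimension (𝒜 : Type u) [Category.{v} 𝒜] [Abelian 𝒜] : Prop :=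
  ∃ d : ℕ, ∀ X : 𝒜, HasProjectiveDimensionLE X d

/-- The (twisted) Ringel–Hall algebra `H_tw(𝒜)`, with `ℂ`-basis `Iso(𝒜)`. -/
@[nolint unusedArguments]
def RingelHall (k : Type*) [Field k] (𝒜 : Type u) [Category.{v} 𝒜] [Abelian 𝒜] [Linear k 𝒜] :
    Type u := IsoClass 𝒜 →₀ ℂ

instance : AddCommGroup (RingelHall k 𝒜) := inferInstanceAs (AddCommGroup (IsoClass 𝒜 →₀ ℂ))
instance : Module ℂ (RingelHall k 𝒜) := inferInstanceAs (Module ℂ (IsoClass 𝒜 →₀ ℂ))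

/-- The bilinear multiplication of `H_tw(𝒜)`, with
`[M] * [N] = v ^ ⟨M, N⟩ ∑_{[L]} |Ext¹(M, N)_L| / |Hom(M, N)| [L]`. -/
instance : Mul (RingelHall k 𝒜) where
  mul x y := Finsupp.sum x fun a r => Finsupp.sum y fun b s =>
    (r * s) • twistedHallProduct (Quotient.out : IsoClass 𝒜 → 𝒜)
      (fun M N => vParam k ^ eulerForm k M N) a b

/-- The basis of `H_tw(𝒜)` formed by the isomorphism classes. -/
def RingelHall.basis : Module.Basis (IsoClass 𝒜) ℂ (RingelHall k 𝒜) := Finsupp.basisSingleOne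

end Abelian

/-! ### The Grothendieck group -/

section Grothendieck

variable (𝒜 : Type u) [Category.{v} 𝒜] [Abelian 𝒜]

/-- The relations `[X₂] = [X₁] + [X₃]` for short exact sequences `0 ⟶ X₁ ⟶ X₂ ⟶ X₃ ⟶ 0`. -/
def grothendieckRelations : AddSubgroup (FreeAbelianGroup 𝒜) :=
  AddSubgroup.closure {z | ∃ S : ShortComplex 𝒜, S.ShortExact ∧
    z = FreeAbelianGroup.of S.X₂ - FreeAbelianGroup.of S.X₁ - FreeAbelianGroup.of S.X₃}

/-- The Grothendieck group `K(𝒜)`. -/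
abbrev GrothendieckK : Type u := FreeAbelianGroup 𝒜 ⧸ grothendieckRelations 𝒜

variable {𝒜}

/-- The class of an object in `K(𝒜)`. -/
def kClass (X : 𝒜) : GrothendieckK 𝒜 := QuotientAddGroup.mk (FreeAbelianGroup.of X)

end Grothendieck

/-! ### 2-cyclic complexes -/

section Complexes

/-- The category `C₂(𝒜)` of 2-cyclic complexes: objects `X 0`, `X 1` with
differentials `d 1 0 : X 1 ⟶ X 0` and `d 0 1 : X 0 ⟶ X 1` whose two composites vanish. -/
abbrev C₂ (𝒜 : Type u) [Category.{v} 𝒜] [Preadditive 𝒜] : Type (max u v) :=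
  HomologicalComplex 𝒜 (ComplexShape.up (ZMod 2))

/-- The 2-cyclic complexes of projective objects. -/
def isProjectiveComplex (𝒜 : Type u) [Category.{v} 𝒜] [Preadditive 𝒜] :
    ObjectProperty (C₂ 𝒜) := fun X => ∀ i, Projective (X.X i)

/-- The full subcategory `C₂(𝒫)` of `C₂(𝒜)`. -/
abbrev C₂P (𝒜 : Type u) [Category.{v} 𝒜] [Preadditive 𝒜] : Type (max u v) :=
  (isProjectiveComplex 𝒜).FullSubcategory

variable {𝒜 : Type u} [Category.{v} 𝒜] [Abelian 𝒜]

/-- The complex with `P` in both degrees whose differential is the identity from degree `a` to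
degree `a + 1` and zero in the other direction. -/
def diskComplex (a : ZMod 2) (P : 𝒜) : C₂ 𝒜 where
  X _ := P
  d i j := if i = a ∧ j = a + 1 then 𝟙 P else 0
  shape i j h := by
    rw [if_neg]
    rintro ⟨rfl, rfl⟩
    exact h rfl
  d_comp_d' i j l _ _ := by
    by_cases h : i = a ∧ j = a + 1
    · rw [if_neg (c := j = a ∧ l = a + 1), comp_zero]
      rintro ⟨h', -⟩
      rw [h.2] at h'
      simp at h'
    · rw [if_neg h, zero_comp]

/-- A disk complex is acyclic. -/
theorem diskComplex_acyclic (a : ZMod 2) (P : 𝒜) : (diskComplex a P).Acyclic := by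
  intro i
  have hp : (ComplexShape.up (ZMod 2)).prev i = i + 1 :=
    ComplexShape.prev_eq' _ (show i + 1 + 1 = i by rw [add_assoc]; exact add_zero i)
  have hn : (ComplexShape.up (ZMod 2)).next i = i + 1 := ComplexShape.next_eq' _ rfl
  rw [HomologicalComplex.exactAt_iff' _ _ _ _ hp hn]
  have key : ∀ i a : ZMod 2, i = a ∨ (i + 1 = a ∧ i = a + 1) := by decide
  rcases key i a with rfl | ⟨h₁, h₂⟩
  · have hg : ((diskComplex i P).sc' (i + 1) i (i + 1)).g = 𝟙 P := by
      simp [diskComplex]; rfl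
    have hf : ((diskComplex i P).sc' (i + 1) i (i + 1)).f = 0 := by
      simp [diskComplex]; rfl
    rw [ShortComplex.exact_iff_mono _ hf, hg]
    exact inferInstanceAs (Mono (𝟙 P))
  · have hf : ((diskComplex a P).sc' (i + 1) i (i + 1)).f = 𝟙 P := by
      simp only [HomologicalComplex.shortComplexFunctor'_obj_f, diskComplex]
      exact if_pos ⟨h₁, h₂⟩
    have hg : ((diskComplex a P).sc' (i + 1) i (i + 1)).g = 0 := by
      simp only [HomologicalComplex.shortComplexFunctor'_obj_g, diskComplex]
      exact if_neg (by rintro ⟨h, -⟩; rw [h₂] at h; simp at h)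
    rw [ShortComplex.exact_iff_epi _ hg, hf]
    exact inferInstanceAs (Epi (𝟙 P))

/-- `K_P`, that is `P ⟶ P` with `d₁ = 1` and `d₀ = 0`. -/
def complexK (P : 𝒜) [hP : Projective P] : C₂P 𝒜 := ⟨diskComplex 1 P, fun _ => hP⟩

/-- `K_P^*`, that is `P ⟶ P` with `d₁ = 0` and `d₀ = 1`. -/
def complexKStar (P : 𝒜) [hP : Projective P] : C₂P 𝒜 := ⟨diskComplex 0 P, fun _ => hP⟩

/-- A finite direct sum of projective objects is projective. -/
theorem projective_biproduct {ι : Type} [Finite ι] (g : ι → 𝒜) (hg : ∀ i, Projective (g i)) :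
    Projective (⨁ g) where
  factors f e _ := ⟨biproduct.desc fun b => Projective.factorThru (biproduct.ι g b ≫ f) e,
    biproduct.hom_ext' _ _ fun b => by simp⟩

/-- The 2-cyclic complex obtained by folding `P_n ⟶ ⋯ ⟶ P_1 ⟶ P_0`: in degree `j` it is the direct
sum of the `P_i` with `0 ≤ i ≤ n` and `i ≡ j` mod 2, and the differential is the matrix formed
by the differentials `P_{i+1} ⟶ P_i` (the other entries `d i i'` are zero). -/
def fold (P : ChainComplex 𝒜 ℕ) (n : ℕ) : C₂ 𝒜 where
  X j := ⨁ fun i : {i : Fin (n + 1) // ((i : ℕ) : ZMod 2) = j} => P.X (i.1 : ℕ)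
  d j j' := biproduct.matrix fun i i' => P.d (i.1 : ℕ) (i'.1 : ℕ)
  shape j j' h := by
    ext i' i
    simp only [biproduct.matrix_π, biproduct.ι_desc, zero_comp, comp_zero]
    refine P.shape _ _ fun hr => h ?_
    have hr' : (i'.1 : ℕ) + 1 = (i.1 : ℕ) := hr
    change j + 1 = j'
    rw [← i.2, ← i'.2, ← hr']
    push_cast
    rw [add_assoc]
    exact add_zero _
  d_comp_d' j j' j'' _ _ := by
    ext i'' i
    simp only [Category.assoc, biproduct.matrix_π, comp_zero, zero_comp]
    rw [biproduct.ι_matrix_assoc, biproduct.lift_desc]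
    simp

end Complexes

/-! ### Bridgeland's Hall algebra -/

section Bridgeland

variable (k : Type*) [Field k] (𝒜 : Type u) [Category.{v} 𝒜] [Abelian 𝒜] [Linear k 𝒜]

/-- The twisted Hall algebra `H_tw(C₂(𝒫))`, with `ℂ`-basis `Iso(C₂(𝒫))`. -/
@[nolint unusedArguments]
def HallC₂P (k : Type*) [Field k] (𝒜 : Type u) [Category.{v} 𝒜] [Abelian 𝒜] [Linear k 𝒜] :
    Type (max u v) := IsoClass (C₂P 𝒜) →₀ ℂ

instance : AddCommGroup (HallC₂P k 𝒜) := inferInstanceAs (AddCommGroup (IsoClass (C₂P 𝒜) →₀ ℂ))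
instance : Module ℂ (HallC₂P k 𝒜) := inferInstanceAs (Module ℂ (IsoClass (C₂P 𝒜) →₀ ℂ))

/-- The bilinear multiplication of `H_tw(C₂(𝒫))`, with
`[M] * [N] = v ^ (⟨M₀, N₀⟩ + ⟨M₁, N₁⟩) ∑_{[L]} |Ext¹(M, N)_L| / |Hom(M, N)| [L]`,
where `Ext¹` and `Hom` are taken in `C₂(𝒜)`. -/
instance : Mul (HallC₂P k 𝒜) where
  mul x y := Finsupp.sum x fun a r => Finsupp.sum y fun b s =>
    (r * s) • twistedHallProduct (fun c : IsoClass (C₂P 𝒜) => c.out.obj)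
      (fun M N => vParam k ^ (eulerForm k (M.X 0) (N.X 0) + eulerForm k (M.X 1) (N.X 1))) a b

/-- The basis of `H_tw(C₂(𝒫))` formed by the isomorphism classes. -/
def HallC₂P.basis : Module.Basis (IsoClass (C₂P 𝒜)) ℂ (HallC₂P k 𝒜) := Finsupp.basisSingleOne

/-- Generators of the localization: the basis elements `[M]` of `H_tw(C₂(𝒫))` and a formal inverse
of `[M]` for each acyclic `M`. -/
inductive LocGen : Type (max u v)
  | cls (c : IsoClass (C₂P 𝒜))
  | inv (M : C₂P 𝒜) (hM : M.obj.Acyclic)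

/-- The linear map from `H_tw(C₂(𝒫))` to the free algebra on the generators. -/
def toFree : HallC₂P k 𝒜 →ₗ[ℂ] FreeAlgebra ℂ (LocGen 𝒜) :=
  (HallC₂P.basis k 𝒜).constr ℂ fun c => FreeAlgebra.ι ℂ (LocGen.cls c)

/-- The relations of the localization: the map from `H_tw(C₂(𝒫))` is a homomorphism of unital
algebras (the unit of `H_tw(C₂(𝒫))` is `[0]`), and the formal inverse of `[M]` for `M` acyclic
is a two-sided inverse of `[M]`. -/
inductive LocRel : FreeAlgebra ℂ (LocGen 𝒜) → FreeAlgebra ℂ (LocGen 𝒜) → Prop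
  | mul (x y : HallC₂P k 𝒜) : LocRel (toFree k 𝒜 x * toFree k 𝒜 y) (toFree k 𝒜 (x * y))
  | one (Z : C₂P 𝒜) (hZ : IsZero Z.obj) :
      LocRel (toFree k 𝒜 (HallC₂P.basis k 𝒜 (isoClass Z))) 1
  | mul_inv (M : C₂P 𝒜) (hM : M.obj.Acyclic) :
      LocRel (toFree k 𝒜 (HallC₂P.basis k 𝒜 (isoClass M)) * FreeAlgebra.ι ℂ (LocGen.inv M hM)) 1
  | inv_mul (M : C₂P 𝒜) (hM : M.obj.Acyclic) :
      LocRel (FreeAlgebra.ι ℂ (LocGen.inv M hM) * toFree k 𝒜 (HallC₂P.basis k 𝒜 (isoClass M))) 1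

/-- Bridgeland's Hall algebra `DH₂(𝒜)`: the localization of `H_tw(C₂(𝒫))` at the classes of
acyclic complexes, that is the `ℂ`-algebra which is universal among those with a homomorphism from
`H_tw(C₂(𝒫))` that sends these classes to invertible elements. -/
def DH₂ : Type (max u v) := RingQuot (LocRel k 𝒜)

instance : Ring (DH₂ k 𝒜) := inferInstanceAs (Ring (RingQuot (LocRel k 𝒜)))
instance : Algebra ℂ (DH₂ k 𝒜) := inferInstanceAs (Algebra ℂ (RingQuot (LocRel k 𝒜)))

/-- The canonical map from the free algebra. -/
def DH₂.mk : FreeAlgebra ℂ (LocGen 𝒜) →ₐ[ℂ] DH₂ k 𝒜 := RingQuot.mkAlgHom ℂ (LocRel k 𝒜)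

/-- The canonical map `H_tw(C₂(𝒫)) ⟶ DH₂(𝒜)`. -/
def DH₂.ofHall : HallC₂P k 𝒜 →ₗ[ℂ] DH₂ k 𝒜 := (DH₂.mk k 𝒜).toLinearMap ∘ₗ toFree k 𝒜

variable {𝒜}

/-- The element `[M]` of `DH₂(𝒜)` for `M` in `C₂(𝒫)`. -/
def DH₂.cls (M : C₂P 𝒜) : DH₂ k 𝒜 := DH₂.ofHall k 𝒜 (HallC₂P.basis k 𝒜 (isoClass M))

/-- The invertible element `[M]` of `DH₂(𝒜)` for `M` acyclic. -/
def DH₂.unit (M : C₂P 𝒜) (hM : M.obj.Acyclic) : (DH₂ k 𝒜)ˣ where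
  val := DH₂.cls k M
  inv := DH₂.mk k 𝒜 (FreeAlgebra.ι ℂ (LocGen.inv M hM))
  val_inv := by
    have h := RingQuot.mkAlgHom_rel ℂ (LocRel.mul_inv (k := k) M hM)
    rw [map_mul, map_one] at h
    exact h
  inv_val := by
    have h := RingQuot.mkAlgHom_rel ℂ (LocRel.inv_mul (k := k) M hM)
    rw [map_mul, map_one] at h
    exact h

/-- `[K_P]` as an invertible element of `DH₂(𝒜)`. -/
def unitK (P : 𝒜) [Projective P] : (DH₂ k 𝒜)ˣ :=
  DH₂.unit k (complexK P) (diskComplex_acyclic 1 P)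

/-- `[K_P^*]` as an invertible element of `DH₂(𝒜)`. -/
def unitKStar (P : 𝒜) [Projective P] : (DH₂ k 𝒜)ˣ :=
  DH₂.unit k (complexKStar P) (diskComplex_acyclic 0 P)

/-- `α ∈ K(𝒜)` is the difference of the classes of the projective objects `P` and `Q`. -/
def IsProjDiff (α : GrothendieckK 𝒜) (PQ : 𝒜 × 𝒜) : Prop :=
  Projective PQ.1 ∧ Projective PQ.2 ∧ α = kClass PQ.1 - kClass PQ.2

open Classical in
/-- `K_α = [K_P] * [K_Q]⁻¹`, where `α = P̂ - Q̂` with `P`, `Q` projective. -/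
def elemK (α : GrothendieckK 𝒜) : (DH₂ k 𝒜)ˣ :=
  if h : ∃ PQ : 𝒜 × 𝒜, IsProjDiff α PQ then
    haveI := h.choose_spec.1
    haveI := h.choose_spec.2.1
    unitK k h.choose.1 * (unitK k h.choose.2)⁻¹
  else 1

open Classical in
/-- `K_α^* = [K_P^*] * [K_Q^*]⁻¹`, where `α = P̂ - Q̂` with `P`, `Q` projective. -/
def elemKStar (α : GrothendieckK 𝒜) : (DH₂ k 𝒜)ˣ :=
  if h : ∃ PQ : 𝒜 × 𝒜, IsProjDiff α PQ then
    haveI := h.choose_spec.1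
    haveI := h.choose_spec.2.1
    unitKStar k h.choose.1 * (unitKStar k h.choose.2)⁻¹
  else 1

end Bridgeland

/-! ### The elements `E_M` -/

section Elements

variable {𝒜 : Type u} [Category.{v} 𝒜] [Abelian 𝒜]

/-- A finite projective resolution `0 ⟶ P_n ⟶ ⋯ ⟶ P_1 ⟶ P_0 ⟶ M ⟶ 0`. -/
structure FiniteResolution (M : 𝒜) extends ProjectiveResolution M where
  /-- the number `n` -/
  length : ℕ
  /-- the resolution vanishes beyond degree `n` -/
  isZero_of_gt : ∀ i, length < i → IsZero (complex.X i)

namespace FiniteResolution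

variable {M : 𝒜} (P : FiniteResolution M)

/-- `M_{j+1}`, the image of `p_{j+1} : P_{j+1} ⟶ P_j`. -/
def syzygy (j : ℕ) : 𝒜 := image (P.complex.d (j + 1) j)

/-- `M_odd`, the direct sum of the `M_i` with `1 ≤ i ≤ n` odd (here `i = j + 1`). -/
def oddPart : 𝒜 := ⨁ fun j : {j : Fin P.length // Odd ((j : ℕ) + 1)} => P.syzygy j.1

/-- `M_even`, the direct sum of the `M_i` with `1 ≤ i ≤ n` even (here `i = j + 1`). -/
def evenPart : 𝒜 := ⨁ fun j : {j : Fin P.length // Even ((j : ℕ) + 1)} => P.syzygy j.1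

/-- `C_M`, the 2-cyclic complex `⨁_{i odd} P_i ⇄ ⨁_{i even} P_i`. -/
def foldedComplex : C₂P 𝒜 :=
  ⟨fold P.complex P.length, fun _ => projective_biproduct _ fun i => P.projective i.1⟩

variable (k : Type*) [Field k] [Linear k 𝒜]

/-- `E_M = v ^ ⟨M_odd - M_even, M⟩ K_{-M_odd} * K^*_{-M_even} * [C_M]`, computed from the
given resolution of `M`. -/
def elemE : DH₂ k 𝒜 :=
  vParam k ^ (eulerForm k P.oddPart M - eulerForm k P.evenPart M) •
    ((elemK k (-kClass P.oddPart) : DH₂ k 𝒜) * (elemKStar k (-kClass P.evenPart) : DH₂ k 𝒜) *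
      DH₂.cls k P.foldedComplex)

end FiniteResolution

/-- The linear map `φ : H_tw(𝒜) ⟶ DH₂(𝒜)`, `[M] ↦ E_M`, where `E_M` is computed from the
resolution `R M`. -/
def phi (k : Type*) [Field k] [Linear k 𝒜] (R : ∀ M : 𝒜, FiniteResolution M) :
    RingelHall k 𝒜 →ₗ[ℂ] DH₂ k 𝒜 :=
  (RingelHall.basis k 𝒜).constr ℂ fun c => (R c.out).elemE k

end Elements

end BridgelandHall

end

open CategoryTheory CategoryTheory.Limits

noncomputable section

namespace BridgelandHall

/-!
Write an extension of complexes of projectives as the graded direct sum with a degree one cocycle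
of the Hom-complex added to the differential. Up to a scalar, the product of `[M]` and `[N]` in
`H_tw(C₂(𝒫))` is then `∑ [L_z]`, the sum running over *all* cocycles `z` from `M` to `N`, and it is
associative because a filtration with three subquotients can be built from either end.

Hence `H_tw(C₂(𝒫))` acts, by translation in the argument, on the functionals on itself, viewed as
functions on isomorphism classes. A disk, that is `K_P` or `K_P^*`, acts diagonally, with nonzero
entries, on the functionals that are invariant under multiplication by disks on the other side. In
finite global dimension every acyclic complex of projectives is a sum of disks, so on these
functionals all acyclic complexes act invertibly and the action extends to `DH₂(𝒜)`. Acting by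
`E_M` on an invariant functional `f` and evaluating at the zero complex gives a nonzero multiple of
`f([C_M])`. Since `H₀(C_M) ≅ M`, linear independence follows from the existence of invariant
functionals that depend on `H₀` only up to isomorphism and separate its isomorphism classes.
-/

universe u v

attribute [local instance] Abelian.hasFiniteBiproducts

/-! ### Cocycles and extensions -/

section Cocycles

variable {ι : Type*} {c : ComplexShape ι} {𝒜 : Type u} [Category.{v} 𝒜] [Preadditive 𝒜]

/-- The degree zero part of the Hom-complex. -/
abbrev DegHom (M N : HomologicalComplex 𝒜 c) : Type _ := ∀ i, M.X i ⟶ N.X i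

/-- The degree one cocycles of the Hom-complex, which are the possible off-diagonal parts of a
differential on the graded object `N ⊞ M` with diagonal part that of `N` and `M`. -/
@[ext]
structure Cocycle (M N : HomologicalComplex 𝒜 c) where
  /-- the components, which vanish where `M ⟶ N` has no degree one part -/
  f : ∀ i j, M.X i ⟶ N.X j
  shape : ∀ i j, ¬ c.Rel i j → f i j = 0
  comm : ∀ i j l, M.d i j ≫ f j l + f i j ≫ N.d j l = 0

namespace Cocycle

variable {M N : HomologicalComplex 𝒜 c}

instance : Zero (Cocycle M N) where
  zero :=
    { f := 0
      shape := by simp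
      comm := by simp }

instance : Add (Cocycle M N) where
  add z w :=
    { f := z.f + w.f
      shape i j hij := by simp [z.shape _ _ hij, w.shape _ _ hij]
      comm i j l := by
        have h := congrArg₂ (· + ·) (z.comm i j l) (w.comm i j l)
        simpa [add_add_add_comm] using h }

instance : Neg (Cocycle M N) where
  neg z :=
    { f := -z.f
      shape i j hij := by simp [z.shape _ _ hij]
      comm i j l := by simpa [-neg_add_rev, ← neg_add] using z.comm i j l }

instance : AddCommGroup (Cocycle M N) where
  add_assoc _ _ _ := Cocycle.ext (add_assoc _ _ _)
  zero_add _ := Cocycle.ext (zero_add _)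
  add_zero _ := Cocycle.ext (add_zero _)
  add_comm _ _ := Cocycle.ext (add_comm _ _)
  neg_add_cancel _ := Cocycle.ext (neg_add_cancel _)
  nsmul := nsmulRec
  zsmul := zsmulRec

@[simp]
lemma zero_f (i j : ι) : (0 : Cocycle M N).f i j = 0 := rfl

@[simp]
lemma add_f (z w : Cocycle M N) (i j : ι) : (z + w).f i j = z.f i j + w.f i j := rfl

instance [Finite ι] [∀ X Y : 𝒜, Finite (X ⟶ Y)] : Finite (Cocycle M N) :=
  Finite.of_injective Cocycle.f fun _ _ h => Cocycle.ext h

/-- The coboundary map of the Hom-complex. -/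
def δ (M N : HomologicalComplex 𝒜 c) : DegHom M N →+ Cocycle M N where
  toFun s :=
    { f i j := s i ≫ N.d i j - M.d i j ≫ s j
      shape i j hij := by simp [N.shape _ _ hij, M.shape _ _ hij]
      comm i j l := by simp }
  map_zero' := by ext; simp
  map_add' s t := by
    ext i j
    simp only [Pi.add_apply, Preadditive.add_comp, Preadditive.comp_add, add_f]
    abel

@[simp]
lemma δ_f (s : DegHom M N) (i j : ι) :
    (δ M N s).f i j = s i ≫ N.d i j - M.d i j ≫ s j := rfl

/-- The kernel of the coboundary map consists of the morphisms of complexes. -/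
def kerδEquiv (M N : HomologicalComplex 𝒜 c) : (δ M N).ker ≃ (M ⟶ N) where
  toFun s :=
    { f := s.1
      comm' i j _ := sub_eq_zero.1 (congrArg (fun z => Cocycle.f z i j) s.2) }
  invFun g := ⟨g.f, by ext; simp⟩
  left_inv _ := rfl
  right_inv _ := rfl

/-- The transport of a cocycle along isomorphisms. -/
@[simps]
def congr {M' N' : HomologicalComplex 𝒜 c} (e : M ≅ M') (e' : N ≅ N') (z : Cocycle M N) :
    Cocycle M' N' where
  f i j := e.inv.f i ≫ z.f i j ≫ e'.hom.f j
  shape i j hij := by simp [z.shape _ _ hij]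
  comm i j l := by simpa using congrArg (fun t => e.inv.f i ≫ t ≫ e'.hom.f l) (z.comm i j l)

/-- Isomorphic pairs of complexes have the same cocycles. -/
def congrEquiv {M' N' : HomologicalComplex 𝒜 c} (e : M ≅ M') (e' : N ≅ N') :
    Cocycle M N ≃ Cocycle M' N' where
  toFun := congr e e'
  invFun := congr e.symm e'.symm
  left_inv z := by
    ext
    simp [← HomologicalComplex.comp_f, ← HomologicalComplex.comp_f_assoc]
  right_inv z := by
    ext
    simp [← HomologicalComplex.comp_f, ← HomologicalComplex.comp_f_assoc]

variable [HasBinaryBiproducts 𝒜]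

/-- The extension of `M` by `N` defined by a cocycle: the graded object `N ⊞ M` with the cocycle
as the off-diagonal part of the differential. -/
def twist (z : Cocycle M N) : HomologicalComplex 𝒜 c where
  X i := N.X i ⊞ M.X i
  d i j := biprod.map (N.d i j) (M.d i j) + biprod.snd ≫ z.f i j ≫ biprod.inl
  shape i j hij := by
    ext <;> simp [N.shape _ _ hij, M.shape _ _ hij, z.shape _ _ hij]
  d_comp_d' i j l _ _ := by
    have h : z.f i j ≫ N.d j l + M.d i j ≫ z.f j l = 0 := by rw [add_comm, z.comm]
    ext <;> simp [h]

/-- The inclusion of `N` in degree `i`. -/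
def inl (z : Cocycle M N) (i : ι) : N.X i ⟶ z.twist.X i :=
  (biprod.inl : N.X i ⟶ N.X i ⊞ M.X i)

/-- The section of the projection to `M` in degree `i`; it is not a morphism of complexes. -/
def inr (z : Cocycle M N) (i : ι) : M.X i ⟶ z.twist.X i :=
  (biprod.inr : M.X i ⟶ N.X i ⊞ M.X i)

/-- The retraction to `N` in degree `i`; it is not a morphism of complexes. -/
def fst (z : Cocycle M N) (i : ι) : z.twist.X i ⟶ N.X i :=
  (biprod.fst : N.X i ⊞ M.X i ⟶ N.X i)

/-- The projection to `M` in degree `i`. -/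
def snd (z : Cocycle M N) (i : ι) : z.twist.X i ⟶ M.X i :=
  (biprod.snd : N.X i ⊞ M.X i ⟶ M.X i)

@[simp]
lemma inl_fst (z : Cocycle M N) (i : ι) : z.inl i ≫ z.fst i = 𝟙 _ := biprod.inl_fst

@[simp]
lemma inl_snd (z : Cocycle M N) (i : ι) : z.inl i ≫ z.snd i = 0 := biprod.inl_snd

@[simp]
lemma inr_fst (z : Cocycle M N) (i : ι) : z.inr i ≫ z.fst i = 0 := biprod.inr_fst

@[simp]
lemma inr_snd (z : Cocycle M N) (i : ι) : z.inr i ≫ z.snd i = 𝟙 _ := biprod.inr_snd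

@[simp]
lemma inl_fst_assoc (z : Cocycle M N) (i : ι) {T : 𝒜} (g : N.X i ⟶ T) :
    z.inl i ≫ z.fst i ≫ g = g := by
  rw [← Category.assoc, inl_fst, Category.id_comp]

@[simp]
lemma inl_snd_assoc (z : Cocycle M N) (i : ι) {T : 𝒜} (g : M.X i ⟶ T) :
    z.inl i ≫ z.snd i ≫ g = 0 := by
  rw [← Category.assoc, inl_snd, zero_comp]

@[simp]
lemma inr_fst_assoc (z : Cocycle M N) (i : ι) {T : 𝒜} (g : N.X i ⟶ T) :
    z.inr i ≫ z.fst i ≫ g = 0 := by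
  rw [← Category.assoc, inr_fst, zero_comp]

@[simp]
lemma inr_snd_assoc (z : Cocycle M N) (i : ι) {T : 𝒜} (g : M.X i ⟶ T) :
    z.inr i ≫ z.snd i ≫ g = g := by
  rw [← Category.assoc, inr_snd, Category.id_comp]

lemma hom_ext (z : Cocycle M N) {i : ι} {T : 𝒜} {g g' : T ⟶ z.twist.X i}
    (h₁ : g ≫ z.fst i = g' ≫ z.fst i) (h₂ : g ≫ z.snd i = g' ≫ z.snd i) : g = g' :=
  biprod.hom_ext (X := N.X i) (Y := M.X i) g g' h₁ h₂

lemma hom_ext' (z : Cocycle M N) {i : ι} {T : 𝒜} {g g' : z.twist.X i ⟶ T}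
    (h₁ : z.inl i ≫ g = z.inl i ≫ g') (h₂ : z.inr i ≫ g = z.inr i ≫ g') : g = g' :=
  biprod.hom_ext' (X := N.X i) (Y := M.X i) g g' h₁ h₂

lemma total (z : Cocycle M N) (i : ι) :
    z.fst i ≫ z.inl i + z.snd i ≫ z.inr i = 𝟙 (z.twist.X i) :=
  biprod.total

@[simp]
lemma inl_twist_d (z : Cocycle M N) (i j : ι) :
    z.inl i ≫ z.twist.d i j = N.d i j ≫ z.inl j := by
  have : (biprod.inl : N.X i ⟶ N.X i ⊞ M.X i) ≫
      (biprod.map (N.d i j) (M.d i j) + biprod.snd ≫ z.f i j ≫ biprod.inl) =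
        N.d i j ≫ biprod.inl := by simp
  exact this

@[simp]
lemma inr_twist_d (z : Cocycle M N) (i j : ι) :
    z.inr i ≫ z.twist.d i j = M.d i j ≫ z.inr j + z.f i j ≫ z.inl j := by
  have : (biprod.inr : M.X i ⟶ N.X i ⊞ M.X i) ≫
      (biprod.map (N.d i j) (M.d i j) + biprod.snd ≫ z.f i j ≫ biprod.inl) =
        M.d i j ≫ biprod.inr + z.f i j ≫ biprod.inl := by simp
  exact this

@[simp]
lemma inl_twist_d_assoc (z : Cocycle M N) (i j : ι) {T : 𝒜} (g : z.twist.X j ⟶ T) :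
    z.inl i ≫ z.twist.d i j ≫ g = N.d i j ≫ z.inl j ≫ g := by
  rw [← Category.assoc, inl_twist_d, Category.assoc]

@[simp]
lemma inr_twist_d_assoc (z : Cocycle M N) (i j : ι) {T : 𝒜} (g : z.twist.X j ⟶ T) :
    z.inr i ≫ z.twist.d i j ≫ g = M.d i j ≫ z.inr j ≫ g + z.f i j ≫ z.inl j ≫ g := by
  rw [← Category.assoc, inr_twist_d, Preadditive.add_comp, Category.assoc, Category.assoc]

@[simp]
lemma twist_d_fst (z : Cocycle M N) (i j : ι) :
    z.twist.d i j ≫ z.fst j = z.fst i ≫ N.d i j + z.snd i ≫ z.f i j :=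
  z.hom_ext' (by simp) (by simp)

@[simp]
lemma twist_d_snd (z : Cocycle M N) (i j : ι) :
    z.twist.d i j ≫ z.snd j = z.snd i ≫ M.d i j :=
  z.hom_ext' (by simp) (by simp)

lemma projective_twist_X (z : Cocycle M N) (i : ι) [Projective (M.X i)]
    [Projective (N.X i)] : Projective (z.twist.X i) :=
  inferInstanceAs (Projective (N.X i ⊞ M.X i))

/-- Morphisms from a component of an extension. -/
def twistHomEquiv (z : Cocycle M N) (i : ι) (Y : 𝒜) :
    (z.twist.X i ⟶ Y) ≃ (N.X i ⟶ Y) × (M.X i ⟶ Y) where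
  toFun g := (z.inl i ≫ g, z.inr i ≫ g)
  invFun g := z.fst i ≫ g.1 + z.snd i ≫ g.2
  left_inv g := z.hom_ext' (by simp) (by simp)
  right_inv g := by ext <;> simp

/-- Morphisms to a component of an extension. -/
def homTwistEquiv (z : Cocycle M N) (i : ι) (Y : 𝒜) :
    (Y ⟶ z.twist.X i) ≃ (Y ⟶ N.X i) × (Y ⟶ M.X i) where
  toFun g := (g ≫ z.fst i, g ≫ z.snd i)
  invFun g := g.1 ≫ z.inl i + g.2 ≫ z.inr i
  left_inv g := z.hom_ext (by simp) (by simp)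
  right_inv g := by ext <;> simp

/-- The transport of a cocycle does not change the extension. -/
def twistCongr {M' N' : HomologicalComplex 𝒜 c} (e : M ≅ M') (e' : N ≅ N') (z : Cocycle M N) :
    z.twist ≅ (congr e e' z).twist :=
  HomologicalComplex.Hom.isoOfComponents
    (fun i =>
      { hom := z.fst i ≫ e'.hom.f i ≫ (congr e e' z).inl i +
          z.snd i ≫ e.hom.f i ≫ (congr e e' z).inr i
        inv := (congr e e' z).fst i ≫ e'.inv.f i ≫ z.inl i +
          (congr e e' z).snd i ≫ e.inv.f i ≫ z.inr i
        hom_inv_id := by simp [← HomologicalComplex.comp_f_assoc, total]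
        inv_hom_id := by simp [← HomologicalComplex.comp_f_assoc, total] })
    (fun i j _ => by
      apply hom_ext <;> apply hom_ext' <;> simp [← HomologicalComplex.comp_f_assoc])

/-- Cohomologous cocycles define isomorphic extensions. -/
def twistAddδ (z : Cocycle M N) (s : DegHom M N) : (z + δ M N s).twist ≅ z.twist :=
  HomologicalComplex.Hom.isoOfComponents
    (fun i =>
      { hom := (z + δ M N s).fst i ≫ z.inl i + (z + δ M N s).snd i ≫ (z.inr i + s i ≫ z.inl i)
        inv := z.fst i ≫ (z + δ M N s).inl i +
          z.snd i ≫ ((z + δ M N s).inr i - s i ≫ (z + δ M N s).inl i)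
        hom_inv_id := by apply hom_ext <;> apply hom_ext' <;> simp
        inv_hom_id := by apply hom_ext <;> apply hom_ext' <;> simp })
    (fun i j _ => by
      apply hom_ext <;> apply hom_ext' <;> simp
      abel)

/-- The extension defined by a coboundary is the direct sum. -/
def twistδ (s : DegHom M N) : (δ M N s).twist ≅ (0 : Cocycle M N).twist :=
  eqToIso (congrArg twist (zero_add _).symm) ≪≫ twistAddδ 0 s

/-- Direct sums do not depend on the order of the summands. -/
def sumComm (M N : HomologicalComplex 𝒜 c) :
    (0 : Cocycle M N).twist ≅ (0 : Cocycle N M).twist :=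
  HomologicalComplex.Hom.isoOfComponents
    (fun i =>
      { hom := fst 0 i ≫ inr 0 i + snd 0 i ≫ inl 0 i
        inv := fst 0 i ≫ inr 0 i + snd 0 i ≫ inl 0 i
        hom_inv_id := by apply hom_ext <;> apply hom_ext' <;> simp
        inv_hom_id := by apply hom_ext <;> apply hom_ext' <;> simp })
    (fun i j _ => by apply hom_ext <;> apply hom_ext' <;> simp)

/-- An extension by a zero complex is the quotient complex. -/
def twistOfIsZero (hN : ∀ i, IsZero (N.X i)) (z : Cocycle M N) : z.twist ≅ M :=
  HomologicalComplex.Hom.isoOfComponents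
    (fun i =>
      { hom := z.snd i
        inv := z.inr i
        hom_inv_id := z.hom_ext ((hN i).eq_of_tgt _ _) (by simp)
        inv_hom_id := by simp })
    (fun i j _ => by simp)

/-- The inclusion of the subcomplex. -/
@[simps]
def inclusion (z : Cocycle M N) : N ⟶ z.twist where
  f := z.inl
  comm' _ _ _ := by simp

/-- The projection to the quotient complex. -/
@[simps]
def projection (z : Cocycle M N) : z.twist ⟶ M where
  f := z.snd
  comm' _ _ _ := by simp

@[simp]
lemma inclusion_projection (z : Cocycle M N) : z.inclusion ≫ z.projection = 0 := by
  ext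
  simp

lemma inclusion_twistAddδ (z : Cocycle M N) (s : DegHom M N) :
    (z + δ M N s).inclusion ≫ (z.twistAddδ s).hom = z.inclusion := by
  ext i
  apply hom_ext <;> simp [twistAddδ]

lemma twistAddδ_projection (z : Cocycle M N) (s : DegHom M N) :
    (z.twistAddδ s).hom ≫ z.projection = (z + δ M N s).projection := by
  ext i
  apply hom_ext' <;> simp [twistAddδ]

section Splitting

variable {L : HomologicalComplex 𝒜 c} {a : N ⟶ L} {p : L ⟶ M} {w : ∀ i, a.f i ≫ p.f i = 0}
  (σ : ∀ i, (ShortComplex.mk (a.f i) (p.f i) (w i)).Splitting)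

/-- The cocycle measuring the failure of a degreewise splitting to be compatible with the
differentials. -/
@[simps]
def ofSplitting : Cocycle M N where
  f i j := (σ i).s ≫ L.d i j ≫ (σ j).r
  shape i j hij := by rw [L.shape _ _ hij, zero_comp, comp_zero]
  comm i j l := by
    have hs : (σ i).s ≫ L.d i j ≫ p.f j = M.d i j := by
      rw [← p.comm, ← Category.assoc, (σ i).s_g, Category.id_comp]
    have hr : a.f l ≫ (σ l).r = 𝟙 _ := (σ l).f_r
    have hid : (σ j).r ≫ a.f j + p.f j ≫ (σ j).s = 𝟙 _ := (σ j).id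
    calc M.d i j ≫ (σ j).s ≫ L.d j l ≫ (σ l).r + ((σ i).s ≫ L.d i j ≫ (σ j).r) ≫ N.d j l
      _ = (σ i).s ≫ L.d i j ≫ ((σ j).r ≫ a.f j + p.f j ≫ (σ j).s) ≫ L.d j l ≫ (σ l).r := by
        simp [add_comm, hr, reassoc_of% hs]
      _ = 0 := by simp [hid]

/-- A degreewise split extension is the one defined by the cocycle of a splitting. -/
def twistOfSplittingIso : (ofSplitting σ).twist ≅ L :=
  HomologicalComplex.Hom.isoOfComponents
    (fun i =>
      have hs : (σ i).s ≫ p.f i = 𝟙 _ := (σ i).s_g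
      have hr : a.f i ≫ (σ i).r = 𝟙 _ := (σ i).f_r
      have hsr : (σ i).s ≫ (σ i).r = 0 := (σ i).s_r
      { hom := (ofSplitting σ).fst i ≫ a.f i + (ofSplitting σ).snd i ≫ (σ i).s
        inv := (σ i).r ≫ (ofSplitting σ).inl i + p.f i ≫ (ofSplitting σ).inr i
        hom_inv_id := by
          apply hom_ext <;> apply hom_ext' <;>
            simp [reassoc_of% hs, reassoc_of% hr, reassoc_of% hsr, reassoc_of% (w i)]
        inv_hom_id := by simpa using (σ i).id })
    (fun i j _ => by
      have hs : (σ i).s ≫ L.d i j ≫ p.f j = M.d i j := by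
        rw [← p.comm, ← Category.assoc, (σ i).s_g, Category.id_comp]
      have hra : (σ j).r ≫ a.f j = 𝟙 _ - p.f j ≫ (σ j).s := (σ j).r_f
      apply hom_ext'
      · simp
      · simp [hra, reassoc_of% hs])

lemma inclusion_twistOfSplittingIso :
    (ofSplitting σ).inclusion ≫ (twistOfSplittingIso σ).hom = a := by
  ext i
  simp [twistOfSplittingIso]

lemma twistOfSplittingIso_projection :
    (twistOfSplittingIso σ).inv ≫ (ofSplitting σ).projection = p := by
  ext i
  simp [twistOfSplittingIso]

end Splitting

section Associativity

variable {A B C : HomologicalComplex 𝒜 c}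

/-- The restriction of a cocycle on an extension to the subcomplex. -/
@[simps]
def restrict {z : Cocycle A B} (w : Cocycle z.twist C) : Cocycle B C where
  f i j := z.inl i ≫ w.f i j
  shape i j hij := by simp [w.shape _ _ hij]
  comm i j l := by simpa using congrArg (fun t => z.inl i ≫ t) (w.comm i j l)

/-- The cocycle presenting the extension `w.twist` of `z.twist` by `C` as an extension of `A` by
`(restrict w).twist`. -/
@[simps]
def toRestrict {z : Cocycle A B} (w : Cocycle z.twist C) : Cocycle A (restrict w).twist where
  f i j := z.inr i ≫ w.f i j ≫ (restrict w).inl j + z.f i j ≫ (restrict w).inr j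
  shape i j hij := by simp [z.shape _ _ hij, w.shape _ _ hij]
  comm i j l := by
    have h := congrArg (fun t => z.inr i ≫ t) (w.comm i j l)
    simp only [Preadditive.comp_add, inr_twist_d_assoc, comp_zero] at h
    apply hom_ext
    · simp only [restrict_f, Preadditive.comp_add, Preadditive.add_comp, Category.assoc,
        inl_twist_d, inr_twist_d, inl_fst, inr_fst, Category.comp_id, comp_zero, add_zero,
        zero_add, zero_comp]
      rw [← h]
      abel
    · simpa using z.comm i j l

/-- The projection of a cocycle with values in an extension to the quotient complex. -/
@[simps]
def project {z : Cocycle B C} (w : Cocycle A z.twist) : Cocycle A B where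
  f i j := w.f i j ≫ z.snd j
  shape i j hij := by simp [w.shape _ _ hij]
  comm i j l := by simpa using congrArg (fun t => t ≫ z.snd l) (w.comm i j l)

/-- The cocycle presenting the extension `w.twist` of `A` by `z.twist` as an extension of
`(project w).twist` by `C`. -/
@[simps]
def ofProject {z : Cocycle B C} (w : Cocycle A z.twist) : Cocycle (project w).twist C where
  f i j := (project w).fst i ≫ z.f i j + (project w).snd i ≫ w.f i j ≫ z.fst j
  shape i j hij := by simp [z.shape _ _ hij, w.shape _ _ hij]
  comm i j l := by
    have h := congrArg (fun t => t ≫ z.fst l) (w.comm i j l)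
    simp only [twist_d_fst, Preadditive.comp_add, Preadditive.add_comp, Category.assoc,
      zero_comp] at h
    apply hom_ext'
    · simpa using z.comm i j l
    · simp only [project_f, Preadditive.comp_add, Preadditive.add_comp, Category.assoc,
        inr_twist_d_assoc, inl_fst_assoc, inl_snd_assoc, inr_fst_assoc, inr_snd_assoc,
        comp_zero, add_zero, zero_add]
      rw [← h]
      abel

lemma sigma_ext {z z' : Cocycle A B} (w : Cocycle z.twist C) (w' : Cocycle z'.twist C)
    (h : ∀ i j, z.f i j = z'.f i j) (h₁ : ∀ i j, z.inl i ≫ w.f i j = z'.inl i ≫ w'.f i j)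
    (h₂ : ∀ i j, z.inr i ≫ w.f i j = z'.inr i ≫ w'.f i j) :
    (⟨z, w⟩ : Σ z : Cocycle A B, Cocycle z.twist C) = ⟨z', w'⟩ := by
  obtain rfl : z = z' := by ext; apply h
  congr
  ext i j
  exact hom_ext' _ (h₁ i j) (h₂ i j)

lemma sigma_ext' {z z' : Cocycle B C} (w : Cocycle A z.twist) (w' : Cocycle A z'.twist)
    (h : ∀ i j, z.f i j = z'.f i j) (h₁ : ∀ i j, w.f i j ≫ z.fst j = w'.f i j ≫ z'.fst j)
    (h₂ : ∀ i j, w.f i j ≫ z.snd j = w'.f i j ≫ z'.snd j) :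
    (⟨z, w⟩ : Σ z : Cocycle B C, Cocycle A z.twist) = ⟨z', w'⟩ := by
  obtain rfl : z = z' := by ext; apply h
  congr
  ext i j
  exact hom_ext _ (h₁ i j) (h₂ i j)

variable (A B C) in
/-- Filtrations with subquotients `C`, `B`, `A` can be built from either end. -/
def assocEquiv :
    (Σ z : Cocycle A B, Cocycle z.twist C) ≃ Σ z : Cocycle B C, Cocycle A z.twist where
  toFun z := ⟨restrict z.2, toRestrict z.2⟩
  invFun z := ⟨project z.2, ofProject z.2⟩
  left_inv := by
    rintro ⟨z, w⟩
    apply sigma_ext <;> simp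
  right_inv := by
    rintro ⟨z, w⟩
    apply sigma_ext' <;> simp

/-- The two ways of building a filtration give isomorphic complexes. -/
def twistAssoc {z : Cocycle A B} (w : Cocycle z.twist C) : w.twist ≅ (toRestrict w).twist :=
  HomologicalComplex.Hom.isoOfComponents
    (fun i =>
      { hom := w.fst i ≫ (restrict w).inl i ≫ (toRestrict w).inl i +
          w.snd i ≫ (z.fst i ≫ (restrict w).inr i ≫ (toRestrict w).inl i +
            z.snd i ≫ (toRestrict w).inr i)
        inv := (toRestrict w).fst i ≫ ((restrict w).fst i ≫ w.inl i +
            (restrict w).snd i ≫ z.inl i ≫ w.inr i) +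
          (toRestrict w).snd i ≫ z.inr i ≫ w.inr i
        hom_inv_id := by
          refine hom_ext' _ ?_ (hom_ext' _ ?_ ?_) <;> simp
        inv_hom_id := by
          refine hom_ext' _ (hom_ext' _ ?_ ?_) ?_ <;> simp })
    (fun i j _ => by
      refine hom_ext _ (hom_ext _ ?_ ?_) ?_ <;> refine hom_ext' _ ?_ (hom_ext' _ ?_ ?_) <;> simp)

end Associativity

end Cocycle

end Cocycles

section Extensions

variable {ι : Type*} {c : ComplexShape ι} {𝒜 : Type u} [Category.{v} 𝒜] [Abelian 𝒜]

namespace Cocycle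

variable {M N L : HomologicalComplex 𝒜 c}

lemma shortExact_twist (z : Cocycle M N) :
    (ShortComplex.mk z.inclusion z.projection z.inclusion_projection).ShortExact :=
  HomologicalComplex.shortExact_of_degreewise_shortExact _ fun i =>
    (ShortComplex.Splitting.mk (z.fst i) (z.inr i) (z.inl_fst i) (z.inr_snd i)
      (z.total i)).shortExact

/-- The extension defined by a cocycle and an isomorphism to its middle term. -/
def extension (z : Cocycle M N) (e : z.twist ≅ L) : Extension M N L :=
  ⟨(z.inclusion ≫ e.hom, e.inv ≫ z.projection), by simp,
    ShortComplex.shortExact_of_iso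
      (ShortComplex.isoMk (Iso.refl N) e (Iso.refl M) (by simp) (by simp)) z.shortExact_twist⟩

lemma exists_extension_eq [∀ i, Projective (M.X i)] (x : Extension M N L) :
    ∃ (z : Cocycle M N) (e : z.twist ≅ L), z.extension e = x := by
  obtain ⟨⟨a, p⟩, w, hx⟩ := x
  have hx' (i : ι) := hx.map_of_exact (HomologicalComplex.eval 𝒜 c i)
  have (i : ι) : Projective ((ShortComplex.mk a p w).map
    (HomologicalComplex.eval 𝒜 c i)).X₃ := inferInstanceAs (Projective (M.X i))
  let σ (i : ι) : (ShortComplex.mk (a.f i) (p.f i)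
      (by rw [← HomologicalComplex.comp_f, w, HomologicalComplex.zero_f])).Splitting :=
    (hx' i).splittingOfProjective
  exact ⟨ofSplitting σ, twistOfSplittingIso σ, Subtype.ext <|
    Prod.ext (inclusion_twistOfSplittingIso σ) (twistOfSplittingIso_projection σ)⟩

lemma sub_mem_range_δ_of_hom {z z' : Cocycle M N} (φ : z'.twist ⟶ z.twist)
    (h₁ : z'.inclusion ≫ φ = z.inclusion) (h₂ : φ ≫ z.projection = z'.projection) :
    z' - z ∈ (δ M N).range := by
  have hl (j : ι) : z'.inl j ≫ φ.f j = z.inl j := congrArg (fun t => t.f j) h₁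
  have hr (i : ι) : φ.f i ≫ z.snd i = z'.snd i := congrArg (fun t => t.f i) h₂
  refine ⟨fun i => z'.inr i ≫ φ.f i ≫ z.fst i, eq_sub_of_add_eq ?_⟩
  ext i j
  have key : z'.inr i ≫ φ.f i ≫ z.twist.d i j ≫ z.fst j =
      z'.inr i ≫ z'.twist.d i j ≫ φ.f j ≫ z.fst j := by rw [φ.comm_assoc]
  simp only [twist_d_fst, Preadditive.comp_add, reassoc_of% hr, inr_snd_assoc,
    inr_twist_d_assoc, reassoc_of% hl, inl_fst, Category.comp_id] at key
  rw [add_f, δ_f, Category.assoc, Category.assoc, sub_add_eq_add_sub, key, add_sub_cancel_left]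

lemma extension_rel_iff (z z' : Cocycle M N) (e : z.twist ≅ L) (e' : z'.twist ≅ L) :
    (extensionSetoid M N L).r (z'.extension e') (z.extension e) ↔ z' - z ∈ (δ M N).range := by
  constructor
  · rintro ⟨g, h₁, h₂⟩
    refine sub_mem_range_δ_of_hom (e' ≪≫ g ≪≫ e.symm).hom ?_ ?_
    · simpa [extension] using congrArg (fun t => t ≫ e.inv) h₁
    · simpa [extension] using congrArg (fun t => e'.hom ≫ t) h₂
  · rintro ⟨s, hs⟩
    obtain rfl : z' = z + δ M N s := by rw [hs, add_sub_cancel]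
    refine ⟨e'.symm ≪≫ z.twistAddδ s ≪≫ e, ?_, ?_⟩
    · simp [extension, reassoc_of% (z.inclusion_twistAddδ s)]
    · simp [extension, twistAddδ_projection]

variable (M N L) in
/-- The cocycles defining an extension with middle term isomorphic to `L`. -/
abbrev WithMiddle : Type _ := {z : Cocycle M N // Nonempty (z.twist ≅ L)}

/-- The class in `Ext¹(M, N)_L` of the extension defined by a cocycle. -/
def extClass (z : WithMiddle M N L) : ExtMiddle M N L :=
  Quotient.mk (extensionSetoid M N L) (z.1.extension z.2.some)

lemma extClass_eq_iff (z z' : WithMiddle M N L) :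
    extClass z' = extClass z ↔ z'.1 - z.1 ∈ (δ M N).range :=
  Quotient.eq.trans (extension_rel_iff _ _ _ _)

lemma extClass_surjective [∀ i, Projective (M.X i)] :
    Function.Surjective (extClass (M := M) (N := N) (L := L)) := by
  intro q
  induction q using Quotient.inductionOn with | _ x
  obtain ⟨z, e, rfl⟩ := exists_extension_eq x
  refine ⟨⟨z, ⟨e⟩⟩, Quotient.sound ((extension_rel_iff _ _ _ _).2 ?_)⟩
  rw [sub_self]
  exact zero_mem _

lemma nonempty_twist_add_iso {z b : Cocycle M N} (hb : b ∈ (δ M N).range) :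
    Nonempty ((z + b).twist ≅ z.twist) := by
  obtain ⟨s, rfl⟩ := hb
  exact ⟨z.twistAddδ s⟩

/-- The cocycles with a given extension class form a torsor under the coboundaries. -/
def extClassFiberEquiv (z : WithMiddle M N L) :
    {z' : WithMiddle M N L // extClass z' = extClass z} ≃ (δ M N).range where
  toFun z' := ⟨z'.1.1 - z.1, (extClass_eq_iff _ _).1 z'.2⟩
  invFun b := ⟨⟨z.1 + b, ⟨(nonempty_twist_add_iso b.2).some ≪≫ z.2.some⟩⟩,
    (extClass_eq_iff _ _).2 (by simp)⟩
  left_inv z' := by simp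
  right_inv b := by simp

variable (M N L) in
theorem card_extMiddle_mul [∀ i, Projective (M.X i)] :
    Nat.card (ExtMiddle M N L) * Nat.card (DegHom M N) =
      Nat.card (WithMiddle M N L) * Nat.card (M ⟶ N) := by
  have e : WithMiddle M N L ≃ ExtMiddle M N L × (δ M N).range := by
    refine (Equiv.sigmaFiberEquiv extClass).symm.trans
      ((Equiv.sigmaCongrRight fun q => ?_).trans (Equiv.sigmaEquivProd _ _))
    refine (Equiv.subtypeEquivRight fun z => ?_).trans
      (extClassFiberEquiv (extClass_surjective q).choose)
    rw [(extClass_surjective q).choose_spec]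
  rw [Nat.card_congr e, Nat.card_prod, ← Nat.card_congr (kerδEquiv M N),
    ← (δ M N).ker.card_mul_index, AddSubgroup.index_ker]
  ring

end Cocycle

end Extensions

section SqrtCard

variable {α β : Type*}

/-- The complex number `√|α|`; it is `0` if `α` is infinite. -/
def sqrtCard (α : Type*) : ℂ := ((Real.sqrt (Nat.card α) : ℝ) : ℂ)

lemma sqrtCard_congr (e : α ≃ β) : sqrtCard α = sqrtCard β := by
  rw [sqrtCard, sqrtCard, Nat.card_congr e]

lemma sqrtCard_prod : sqrtCard (α × β) = sqrtCard α * sqrtCard β := by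
  simp [sqrtCard]

lemma sqrtCard_mul_self : sqrtCard α * sqrtCard α = Nat.card α := by
  rw [sqrtCard, ← Complex.ofReal_mul, Real.mul_self_sqrt (Nat.cast_nonneg _)]
  simp

lemma sqrtCard_of_unique [Unique α] : sqrtCard α = 1 := by simp [sqrtCard]

lemma sqrtCard_ne_zero (α : Type*) [Finite α] [Nonempty α] : sqrtCard α ≠ 0 := by
  simpa [sqrtCard] using (Nat.card_pos (α := α)).ne'

end SqrtCard

section Euler

variable {k : Type*} [Field k] {𝒜 : Type u} [Category.{v} 𝒜] [Abelian 𝒜] [Linear k 𝒜]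

lemma IsFinitary.finite_homs [Finite k] (hfin : IsFinitary k 𝒜) (X Y : 𝒜) :
    Finite (X ⟶ Y) := by
  have := hfin.finite_hom X Y
  exact Module.finite_of_finite k

lemma vParam_ne_zero (k : Type*) [Field k] [Finite k] : vParam k ≠ 0 := sqrtCard_ne_zero k

lemma eulerForm_of_projective (P Y : 𝒜) [Projective P] :
    eulerForm k P Y = Module.finrank k (P ⟶ Y) := by
  let := HasExt.standard 𝒜
  rw [eulerForm, finsum_eq_single _ 0]
  · rw [pow_zero, one_mul, extDim, (Abelian.Ext.linearEquiv₀ (R := k)).finrank_eq]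
  · intro i hi
    have : Subsingleton (Abelian.Ext.{max u v} P Y i) :=
      HasProjectiveDimensionLT.subsingleton P 1 i (Nat.one_le_iff_ne_zero.2 hi) Y
    rw [extDim, Module.finrank_zero_of_subsingleton, Nat.cast_zero, mul_zero]

lemma vParam_zpow_eulerForm [Finite k] (P Y : 𝒜) [Projective P] [Finite (P ⟶ Y)] :
    vParam k ^ eulerForm k P Y = sqrtCard (P ⟶ Y) := by
  rw [eulerForm_of_projective, zpow_natCast, sqrtCard, Module.natCard_eq_pow_finrank (K := k),
    vParam, ← Complex.ofReal_pow, Nat.cast_pow, Complex.ofReal_inj, eq_comm,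
    Real.sqrt_eq_iff_mul_self_eq (by positivity) (by positivity), ← mul_pow,
    Real.mul_self_sqrt (Nat.cast_nonneg _)]

end Euler

/-! ### The Hall algebra of 2-cyclic complexes of projectives -/

section HallSum

variable {𝒜 : Type u} [Category.{v} 𝒜] [Abelian 𝒜]

instance (X : C₂P 𝒜) (i : ZMod 2) : Projective (X.obj.X i) := X.property i

/-- The extension defined by a cocycle, as an object of `C₂(𝒫)`. -/
def twistP {M N : C₂P 𝒜} (z : Cocycle M.obj N.obj) : C₂P 𝒜 :=
  ⟨z.twist, fun i => z.projective_twist_X i⟩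

lemma isoClass_eq_iff {X Y : C₂P 𝒜} : isoClass X = isoClass Y ↔ Nonempty (X.obj ≅ Y.obj) :=
  Quotient.eq.trans ⟨fun ⟨e⟩ => ⟨(isProjectiveComplex 𝒜).ι.mapIso e⟩,
    fun ⟨e⟩ => ⟨(isProjectiveComplex 𝒜).fullyFaithfulι.preimageIso e⟩⟩

lemma nonempty_out_iso (X : C₂P 𝒜) : Nonempty ((isoClass X).out.obj ≅ X.obj) :=
  isoClass_eq_iff.1 (Quotient.out_eq (isoClass X))

lemma isoClass_twistP_eq_iff {M N : C₂P 𝒜} (z : Cocycle M.obj N.obj) (c : IsoClass (C₂P 𝒜)) :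
    isoClass (twistP z) = c ↔ Nonempty (z.twist ≅ c.out.obj) := by
  conv_lhs => rw [← Quotient.out_eq c]
  exact isoClass_eq_iff

section DegHom

variable {A B C : C₂ 𝒜}

lemma sqrtCard_degHom_congr {A' B' : C₂ 𝒜} (e : A ≅ A') (e' : B ≅ B') :
    sqrtCard (DegHom A B) = sqrtCard (DegHom A' B') :=
  sqrtCard_congr (Equiv.piCongrRight fun i =>
    Iso.homCongr ((HomologicalComplex.eval 𝒜 _ i).mapIso e)
      ((HomologicalComplex.eval 𝒜 _ i).mapIso e'))

lemma sqrtCard_degHom_twist_left (z : Cocycle A B) :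
    sqrtCard (DegHom z.twist C) = sqrtCard (DegHom B C) * sqrtCard (DegHom A C) :=
  (sqrtCard_congr ((Equiv.piCongrRight fun i => z.twistHomEquiv i (C.X i)).trans
    (Equiv.arrowProdEquivProdArrow _ _ _))).trans sqrtCard_prod

lemma sqrtCard_degHom_twist_right (z : Cocycle B C) :
    sqrtCard (DegHom A z.twist) = sqrtCard (DegHom A C) * sqrtCard (DegHom A B) :=
  (sqrtCard_congr ((Equiv.piCongrRight fun i => z.homTwistEquiv i (A.X i)).trans
    (Equiv.arrowProdEquivProdArrow _ _ _))).trans sqrtCard_prod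

variable (A B) in
lemma sqrtCard_degHom (a : ZMod 2) : sqrtCard (DegHom A B) =
    sqrtCard (A.X a ⟶ B.X a) * sqrtCard (A.X (a + 1) ⟶ B.X (a + 1)) := by
  have h : sqrtCard (DegHom A B) = sqrtCard (A.X 0 ⟶ B.X 0) * sqrtCard (A.X 1 ⟶ B.X 1) :=
    (sqrtCard_congr (piFinTwoEquiv fun i : ZMod 2 => A.X i ⟶ B.X i)).trans sqrtCard_prod
  obtain rfl | rfl : a = 0 ∨ a = 1 := by revert a; decide
  · exact h
  · exact h.trans (mul_comm _ _)

end DegHom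

variable [∀ X Y : 𝒜, Finite (X ⟶ Y)]

instance (M N : C₂ 𝒜) : Fintype (Cocycle M N) := Fintype.ofFinite _

variable {E E' : Type*} [AddCommMonoid E] [Module ℂ E] [AddCommMonoid E'] [Module ℂ E']

/-- The value at `[M] * [N]` of the linear map on the Hall algebra `H_tw(C₂(𝒫))` which extends
the function `F` on its basis. -/
def hallSum (M N : C₂P 𝒜) (F : IsoClass (C₂P 𝒜) → E) : E :=
  (sqrtCard (DegHom M.obj N.obj))⁻¹ • ∑ z : Cocycle M.obj N.obj, F (isoClass (twistP z))

lemma map_hallSum (φ : E →ₗ[ℂ] E') (M N : C₂P 𝒜) (F : IsoClass (C₂P 𝒜) → E) :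
    φ (hallSum M N F) = hallSum M N fun c => φ (F c) := by
  rw [hallSum, map_smul, map_sum, hallSum]

lemma hallSum_congr {M M' N N' : C₂P 𝒜} (e : M.obj ≅ M'.obj) (e' : N.obj ≅ N'.obj)
    (F : IsoClass (C₂P 𝒜) → E) : hallSum M N F = hallSum M' N' F := by
  rw [hallSum, hallSum, sqrtCard_degHom_congr e e']
  congr 1
  exact Fintype.sum_equiv (Cocycle.congrEquiv e e') _ _ fun z =>
    congrArg F (isoClass_eq_iff.2 ⟨z.twistCongr e e'⟩)

lemma hallSum_out_left (M N : C₂P 𝒜) (F : IsoClass (C₂P 𝒜) → E) :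
    hallSum (isoClass M).out N F = hallSum M N F :=
  hallSum_congr (nonempty_out_iso M).some (Iso.refl _) F

lemma hallSum_out_right (M N : C₂P 𝒜) (F : IsoClass (C₂P 𝒜) → E) :
    hallSum M (isoClass N).out F = hallSum M N F :=
  hallSum_congr (Iso.refl _) (nonempty_out_iso N).some F

-- Both sides sum over the complexes with a two-step filtration with graded pieces `C`, `B`, `A`.
theorem hallSum_assoc (A B C : C₂P 𝒜) (F : IsoClass (C₂P 𝒜) → E) :
    hallSum A B (fun c => hallSum c.out C F) = hallSum B C fun c => hallSum A c.out F := by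
  have hl (z : Cocycle A.obj B.obj) : sqrtCard (DegHom (twistP z).obj C.obj) =
    sqrtCard (DegHom B.obj C.obj) * sqrtCard (DegHom A.obj C.obj) :=
      sqrtCard_degHom_twist_left z
  have hr (z : Cocycle B.obj C.obj) : sqrtCard (DegHom A.obj (twistP z).obj) =
    sqrtCard (DegHom A.obj C.obj) * sqrtCard (DegHom A.obj B.obj) :=
      sqrtCard_degHom_twist_right z
  have filtrations :
      ∑ z : Cocycle A.obj B.obj, ∑ w : Cocycle (twistP z).obj C.obj, F (isoClass (twistP w)) =
        ∑ z : Cocycle B.obj C.obj, ∑ w : Cocycle A.obj (twistP z).obj,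
          F (isoClass (twistP w)) := by
    rw [← Fintype.sum_sigma', ← Fintype.sum_sigma']
    exact Fintype.sum_equiv (Cocycle.assocEquiv _ _ _) _ _ fun z =>
      congrArg F (isoClass_eq_iff.2 ⟨Cocycle.twistAssoc z.2⟩)
  rw [hallSum, hallSum]
  simp only [hallSum_out_left, hallSum_out_right]
  simp only [hallSum, hl, hr, ← Finset.smul_sum, filtrations, smul_smul]
  congr 1
  ring

lemma hallSum_of_surjective_δ {M N : C₂P 𝒜}
    (h : Function.Surjective (Cocycle.δ M.obj N.obj)) (F : IsoClass (C₂P 𝒜) → E) :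
    hallSum M N F = ((sqrtCard (DegHom M.obj N.obj))⁻¹ * Nat.card (Cocycle M.obj N.obj)) •
      F (isoClass (twistP (0 : Cocycle M.obj N.obj))) := by
  have (z : Cocycle M.obj N.obj) :
      isoClass (twistP z) = isoClass (twistP (0 : Cocycle M.obj N.obj)) := by
    obtain ⟨s, rfl⟩ := h z
    exact isoClass_eq_iff.2 ⟨Cocycle.twistδ s⟩
  rw [hallSum, Finset.sum_congr rfl fun z _ => congrArg F (this z), Finset.sum_const,
    Finset.card_univ, ← Nat.card_eq_fintype_card, ← Nat.cast_smul_eq_nsmul ℂ, smul_smul]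

variable (k : Type*) [Field k] [Finite k] [Linear k 𝒜]

lemma vParam_zpow_mul_hallNumber (M N : C₂P 𝒜) (L : C₂ 𝒜) :
    vParam k ^ (eulerForm k (M.obj.X 0) (N.obj.X 0) + eulerForm k (M.obj.X 1) (N.obj.X 1)) *
        hallNumber M.obj N.obj L =
      (sqrtCard (DegHom M.obj N.obj))⁻¹ * Nat.card (Cocycle.WithMiddle M.obj N.obj L) := by
  have hv : vParam k ^ (eulerForm k (M.obj.X 0) (N.obj.X 0) +
      eulerForm k (M.obj.X 1) (N.obj.X 1)) = sqrtCard (DegHom M.obj N.obj) := by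
    rw [zpow_add₀ (vParam_ne_zero k), vParam_zpow_eulerForm, vParam_zpow_eulerForm]
    exact (sqrtCard_degHom M.obj N.obj 0).symm
  have : Finite (M.obj ⟶ N.obj) :=
    Finite.of_injective (fun g => g.f) fun _ _ h => HomologicalComplex.hom_ext _ _ (congrFun h)
  have hcard : (Nat.card (M.obj ⟶ N.obj) : ℂ) ≠ 0 := Nat.cast_ne_zero.2 Nat.card_pos.ne'
  have key : (Nat.card (ExtMiddle M.obj N.obj L) : ℂ) *
      (sqrtCard (DegHom M.obj N.obj) * sqrtCard (DegHom M.obj N.obj)) =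
      Nat.card (Cocycle.WithMiddle M.obj N.obj L) * Nat.card (M.obj ⟶ N.obj) := by
    rw [sqrtCard_mul_self]
    exact_mod_cast Cocycle.card_extMiddle_mul M.obj N.obj L
  have := sqrtCard_ne_zero (DegHom M.obj N.obj)
  rw [hv, hallNumber]
  field_simp
  linear_combination key

lemma finsum_single_apply {I R : Type*} [AddCommMonoid R] (x : I →₀ R) :
    ∑ᶠ c, Finsupp.single c (x c) = x := by
  rw [finsum_eq_sum_of_support_subset (s := x.support)]
  · exact x.sum_single
  · intro c hc
    simpa using hc

lemma hallSum_single_apply (M N : C₂P 𝒜) (c : IsoClass (C₂P 𝒜)) :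
    hallSum M N (fun d => Finsupp.single d (1 : ℂ)) c =
      (sqrtCard (DegHom M.obj N.obj))⁻¹ * Nat.card (Cocycle.WithMiddle M.obj N.obj c.out.obj) := by
  classical
  simp only [hallSum, Finsupp.smul_apply, Finsupp.finsetSum_apply, Finsupp.single_apply,
    isoClass_twistP_eq_iff, Finset.sum_boole, smul_eq_mul]
  rw [Nat.card_eq_fintype_card, Fintype.card_subtype]

theorem twistedHallProduct_eq_hallSum (a b : IsoClass (C₂P 𝒜)) :
    twistedHallProduct (fun c : IsoClass (C₂P 𝒜) => c.out.obj)
        (fun M N => vParam k ^ (eulerForm k (M.X 0) (N.X 0) + eulerForm k (M.X 1) (N.X 1))) a b =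
      hallSum a.out b.out fun c => Finsupp.single c 1 := by
  rw [twistedHallProduct, ← finsum_single_apply (hallSum _ _ _)]
  simp only [vParam_zpow_mul_hallNumber, hallSum_single_apply]

end HallSum

/-! ### Disk complexes -/

section Disks

variable {𝒜 : Type u} [Category.{v} 𝒜] [Abelian 𝒜]

lemma isIso_diskComplex_d (a : ZMod 2) (P : 𝒜) : IsIso ((diskComplex a P).d a (a + 1)) := by
  have : (diskComplex a P).d a (a + 1) = 𝟙 P := by simp [diskComplex]
  rw [this]
  exact inferInstanceAs (IsIso (𝟙 P))

lemma zmod_two_cases (a i : ZMod 2) : i = a ∨ i = a + 1 := by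
  revert a i; decide

lemma zmod_two_add_one_add_one (a : ZMod 2) : a + 1 + 1 = a := by
  revert a; decide

lemma zmod_two_add_one_ne (a : ZMod 2) : a + 1 ≠ a := by
  revert a; decide

namespace Cocycle

lemma ext_zmod_two {M N : C₂ 𝒜} {z w : Cocycle M N} (a : ZMod 2)
    (h₁ : z.f a (a + 1) = w.f a (a + 1)) (h₂ : z.f (a + 1) a = w.f (a + 1) a) : z = w := by
  ext i j
  by_cases hij : i + 1 = j
  · subst hij
    obtain rfl | rfl := zmod_two_cases a i
    · exact h₁
    · rwa [zmod_two_add_one_add_one]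
  · rw [z.shape _ _ hij, w.shape _ _ hij]

lemma bijective_δ_single_of_isIso_source (a : ZMod 2) (D X : C₂ 𝒜) [IsIso (D.d a (a + 1))] :
    Function.Bijective fun g : D.X (a + 1) ⟶ X.X (a + 1) => δ D X (Pi.single (a + 1) g) := by
  have h₁ (g : D.X (a + 1) ⟶ X.X (a + 1)) :
      (δ D X (Pi.single (a + 1) g)).f a (a + 1) = -(D.d a (a + 1) ≫ g) := by
    simp [(zmod_two_add_one_ne a).symm]
  have h₂ (g : D.X (a + 1) ⟶ X.X (a + 1)) :
      (δ D X (Pi.single (a + 1) g)).f (a + 1) a = g ≫ X.d (a + 1) a := by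
    simp [(zmod_two_add_one_ne a).symm]
  refine ⟨fun g g' h => ?_, fun z => ?_⟩
  · have := congrArg (fun z => z.f a (a + 1)) h
    dsimp only at this
    rwa [h₁, h₁, neg_inj, cancel_epi] at this
  · refine ⟨-(inv (D.d a (a + 1)) ≫ z.f a (a + 1)), ext_zmod_two a (by simp [h₁]) ?_⟩
    rw [h₂, ← cancel_epi (D.d a (a + 1)), eq_comm, ← sub_eq_zero, ← z.comm a (a + 1) a]
    simp

lemma bijective_δ_single_of_isIso_target (a : ZMod 2) (D X : C₂ 𝒜) [IsIso (D.d a (a + 1))] :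
    Function.Bijective fun g : X.X a ⟶ D.X a => δ X D (Pi.single a g) := by
  have h₁ (g : X.X a ⟶ D.X a) :
      (δ X D (Pi.single a g)).f a (a + 1) = g ≫ D.d a (a + 1) := by
    simp [zmod_two_add_one_ne a]
  have h₂ (g : X.X a ⟶ D.X a) :
      (δ X D (Pi.single a g)).f (a + 1) a = -(X.d (a + 1) a ≫ g) := by
    simp [zmod_two_add_one_ne a]
  refine ⟨fun g g' h => ?_, fun z => ?_⟩
  · have := congrArg (fun z => z.f a (a + 1)) h
    dsimp only at this
    rwa [h₁, h₁, cancel_mono] at this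
  · refine ⟨z.f a (a + 1) ≫ inv (D.d a (a + 1)), ext_zmod_two a (by simp [h₁]) ?_⟩
    rw [h₂, ← cancel_mono (D.d a (a + 1)), eq_comm, ← sub_eq_zero, ← z.comm (a + 1) a (a + 1)]
    simp [add_comm]

end Cocycle

/-- The direct sum in `C₂(𝒫)`. -/
def sumP (M N : C₂P 𝒜) : C₂P 𝒜 := twistP (0 : Cocycle M.obj N.obj)

lemma isoClass_sumP_comm (M N : C₂P 𝒜) : isoClass (sumP M N) = isoClass (sumP N M) :=
  isoClass_eq_iff.2 ⟨Cocycle.sumComm M.obj N.obj⟩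

/-- The disk complex on a projective object, as an object of `C₂(𝒫)`; it is `K_P` for `a = 1` and
`K_P^*` for `a = 0`. -/
def diskP (a : ZMod 2) (P : 𝒜) [hP : Projective P] : C₂P 𝒜 := ⟨diskComplex a P, fun _ => hP⟩

lemma isZero_X {Z : C₂ 𝒜} (hZ : IsZero Z) (i : ZMod 2) : IsZero (Z.X i) :=
  (HomologicalComplex.eval 𝒜 _ i).map_isZero hZ

/-- The scalar by which the class of a disk complex acts on the value of an invariant functional
at `[X]`. -/
def diskScalar (a : ZMod 2) (P : 𝒜) (X : C₂P 𝒜) : ℂ :=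
  sqrtCard (X.obj.X a ⟶ P) * sqrtCard (P ⟶ X.obj.X a) /
    (sqrtCard (X.obj.X (a + 1) ⟶ P) * sqrtCard (P ⟶ X.obj.X (a + 1)))

lemma diskScalar_congr (a : ZMod 2) (P : 𝒜) {X Y : C₂P 𝒜} (e : X.obj ≅ Y.obj) :
    diskScalar a P X = diskScalar a P Y := by
  have e' (i : ZMod 2) : X.obj.X i ≅ Y.obj.X i := (HomologicalComplex.eval 𝒜 _ i).mapIso e
  have hl (i : ZMod 2) : sqrtCard (X.obj.X i ⟶ P) = sqrtCard (Y.obj.X i ⟶ P) :=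
    sqrtCard_congr ((e' i).homCongr (Iso.refl P))
  have hr (i : ZMod 2) : sqrtCard (P ⟶ X.obj.X i) = sqrtCard (P ⟶ Y.obj.X i) :=
    sqrtCard_congr ((Iso.refl P).homCongr (e' i))
  simp only [diskScalar, hl, hr]

variable [∀ X Y : 𝒜, Finite (X ⟶ Y)]
variable {E : Type*} [AddCommMonoid E] [Module ℂ E] (a : ZMod 2) (P : 𝒜) [Projective P] (X : C₂P 𝒜)

lemma hallSum_disk_left (F : IsoClass (C₂P 𝒜) → E) :
    hallSum (diskP a P) X F = (sqrtCard (P ⟶ X.obj.X (a + 1)) / sqrtCard (P ⟶ X.obj.X a)) •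
      F (isoClass (sumP (diskP a P) X)) := by
  have := isIso_diskComplex_d a P
  have hδ := Cocycle.bijective_δ_single_of_isIso_source a (diskComplex a P) X.obj
  have hcard : (Nat.card (Cocycle (diskComplex a P) X.obj) : ℂ) =
      sqrtCard (P ⟶ X.obj.X (a + 1)) * sqrtCard (P ⟶ X.obj.X (a + 1)) := by
    rw [sqrtCard_mul_self, ← Nat.card_congr (Equiv.ofBijective _ hδ)]
    rfl
  have hdeg : sqrtCard (DegHom (diskComplex a P) X.obj) =
      sqrtCard (P ⟶ X.obj.X a) * sqrtCard (P ⟶ X.obj.X (a + 1)) := sqrtCard_degHom _ _ a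
  have h₀ := sqrtCard_ne_zero (P ⟶ X.obj.X (a + 1))
  rw [hallSum_of_surjective_δ (M := diskP a P) hδ.surjective.of_comp]
  simp only [diskP, hcard, hdeg]
  congr 1
  field_simp

lemma hallSum_disk_right (F : IsoClass (C₂P 𝒜) → E) :
    hallSum X (diskP a P) F = (sqrtCard (X.obj.X a ⟶ P) / sqrtCard (X.obj.X (a + 1) ⟶ P)) •
      F (isoClass (sumP (diskP a P) X)) := by
  have := isIso_diskComplex_d a P
  have hδ := Cocycle.bijective_δ_single_of_isIso_target a (diskComplex a P) X.obj
  have hcard : (Nat.card (Cocycle X.obj (diskComplex a P)) : ℂ) =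
      sqrtCard (X.obj.X a ⟶ P) * sqrtCard (X.obj.X a ⟶ P) := by
    rw [sqrtCard_mul_self, ← Nat.card_congr (Equiv.ofBijective _ hδ)]
    rfl
  have hdeg : sqrtCard (DegHom X.obj (diskComplex a P)) =
      sqrtCard (X.obj.X a ⟶ P) * sqrtCard (X.obj.X (a + 1) ⟶ P) := sqrtCard_degHom _ _ a
  have h₀ := sqrtCard_ne_zero (X.obj.X a ⟶ P)
  rw [hallSum_of_surjective_δ (N := diskP a P) hδ.surjective.of_comp, isoClass_sumP_comm]
  simp only [diskP, hcard, hdeg]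
  congr 1
  field_simp

end Disks

/-! ### The action on invariant functionals -/

section Action

variable {𝒜 : Type u} [Category.{v} 𝒜] [Abelian 𝒜] [∀ X Y : 𝒜, Finite (X ⟶ Y)]

variable (𝒜) in
/-- The linear functionals on the Hall algebra, considered as functions on its basis, which are
invariant under left multiplication by the classes of the disk complexes. -/
def invariants : Submodule ℂ (IsoClass (C₂P 𝒜) → ℂ) where
  carrier := {f | ∀ (a : ZMod 2) (P : 𝒜) [Projective P] (X : C₂P 𝒜),
    hallSum (diskP a P) X f = f (isoClass X)}
  add_mem' hf hg a P _ X := by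
    rw [Pi.add_apply, ← hf a P X, ← hg a P X]
    simp [hallSum, Finset.sum_add_distrib, mul_add]
  zero_mem' a P _ X := by simp [hallSum]
  smul_mem' r f hf a P _ X := by
    rw [Pi.smul_apply, ← hf a P X]
    exact (map_hallSum (r • LinearMap.id) _ _ f).symm

lemma mem_invariants_iff {f : IsoClass (C₂P 𝒜) → ℂ} :
    f ∈ invariants 𝒜 ↔ ∀ (a : ZMod 2) (P : 𝒜) [Projective P] (X : C₂P 𝒜),
      sqrtCard (P ⟶ X.obj.X (a + 1)) / sqrtCard (P ⟶ X.obj.X a) *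
        f (isoClass (sumP (diskP a P) X)) = f (isoClass X) := by
  simp only [← smul_eq_mul, ← hallSum_disk_left]
  rfl

/-- The action of `[N]` on the invariant functionals that is dual to the right multiplication by
`[N]`. -/
def act (c : IsoClass (C₂P 𝒜)) : Module.End ℂ (invariants 𝒜) where
  toFun f := ⟨fun a => hallSum a.out c.out f.1, fun a P _ X => by
    have hf : (fun b : IsoClass (C₂P 𝒜) => hallSum (diskP a P) b.out f.1) = f.1 :=
      funext fun b => (f.2 a P b.out).trans (congrArg f.1 b.out_eq)
    rw [hallSum_assoc, hf]
    exact (hallSum_out_left _ _ _).symm⟩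
  map_add' f g := by ext; simp [hallSum, Finset.sum_add_distrib, mul_add]
  map_smul' r f := by ext; exact (map_hallSum (r • LinearMap.id) _ _ f.1).symm

lemma act_isoClass_apply (N X : C₂P 𝒜) (f : invariants 𝒜) :
    (act (isoClass N) f).1 (isoClass X) = hallSum X N f.1 :=
  (hallSum_out_left _ _ _).trans (hallSum_out_right _ _ _)

lemma act_mul_act (c c' : IsoClass (C₂P 𝒜)) : act c * act c' = hallSum c.out c'.out act := by
  ext f a
  refine (hallSum_assoc a.out c.out c'.out f.1).trans ?_
  exact (map_hallSum (LinearMap.proj a ∘ₗ (invariants 𝒜).subtype ∘ₗ LinearMap.applyₗ f)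
    c.out c'.out act).symm

lemma hallSum_of_subsingleton {E : Type*} [AddCommMonoid E] [Module ℂ E] {M N : C₂P 𝒜}
    [h : ∀ i j, Subsingleton (M.obj.X i ⟶ N.obj.X j)] (F : IsoClass (C₂P 𝒜) → E) :
    hallSum M N F = F (isoClass (sumP M N)) := by
  have : Subsingleton (Cocycle M.obj N.obj) :=
    ⟨fun z w => Cocycle.ext (funext₂ fun _ _ => Subsingleton.elim _ _)⟩
  have : Unique (DegHom M.obj N.obj) := ⟨⟨0⟩, fun _ => funext fun _ => Subsingleton.elim _ _⟩
  rw [hallSum, sqrtCard_of_unique, inv_one, one_smul, Fintype.sum_subsingleton _ 0, sumP]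

lemma act_of_isZero (Z : C₂P 𝒜) (hZ : IsZero Z.obj) : act (isoClass Z) = 1 := by
  ext f c
  induction c using Quotient.inductionOn with | _ X
  have (i j : ZMod 2) : Subsingleton (X.obj.X i ⟶ Z.obj.X j) := ⟨(isZero_X hZ j).eq_of_tgt⟩
  refine (act_isoClass_apply Z X f).trans ((hallSum_of_subsingleton f.1).trans ?_)
  exact congrArg f.1 (isoClass_eq_iff.2 ⟨Cocycle.twistOfIsZero (isZero_X hZ) 0⟩)

lemma act_apply_of_isZero (c : IsoClass (C₂P 𝒜)) (Z : C₂P 𝒜) (hZ : IsZero Z.obj)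
    (f : invariants 𝒜) : (act c f).1 (isoClass Z) = f.1 c := by
  induction c using Quotient.inductionOn with | _ X
  have (i j : ZMod 2) : Subsingleton (Z.obj.X i ⟶ X.obj.X j) := ⟨(isZero_X hZ i).eq_of_src⟩
  rw [act_isoClass_apply, hallSum_of_subsingleton, isoClass_sumP_comm]
  exact congrArg f.1 (isoClass_eq_iff.2 ⟨Cocycle.twistOfIsZero (isZero_X hZ) 0⟩)

lemma diskScalar_ne_zero (a : ZMod 2) (P : 𝒜) (X : C₂P 𝒜) : diskScalar a P X ≠ 0 :=
  div_ne_zero (mul_ne_zero (sqrtCard_ne_zero _) (sqrtCard_ne_zero _))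
    (mul_ne_zero (sqrtCard_ne_zero _) (sqrtCard_ne_zero _))

lemma diskScalar_sumP_disk (a b : ZMod 2) (P Q : 𝒜) [Projective Q] (X : C₂P 𝒜) :
    diskScalar a P (sumP (diskP b Q) X) = diskScalar a P X := by
  have hl (i : ZMod 2) : sqrtCard ((sumP (diskP b Q) X).obj.X i ⟶ P) =
      sqrtCard (X.obj.X i ⟶ P) * sqrtCard (Q ⟶ P) :=
    (sqrtCard_congr (Cocycle.twistHomEquiv 0 i P)).trans sqrtCard_prod
  have hr (i : ZMod 2) : sqrtCard (P ⟶ (sumP (diskP b Q) X).obj.X i) =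
      sqrtCard (P ⟶ X.obj.X i) * sqrtCard (P ⟶ Q) :=
    (sqrtCard_congr (Cocycle.homTwistEquiv 0 i P)).trans sqrtCard_prod
  have h₁ := sqrtCard_ne_zero (P ⟶ Q)
  have h₂ := sqrtCard_ne_zero (Q ⟶ P)
  have h₃ := sqrtCard_ne_zero (P ⟶ X.obj.X (a + 1))
  have h₄ := sqrtCard_ne_zero (X.obj.X (a + 1) ⟶ P)
  simp only [diskScalar, hl, hr]
  field_simp

lemma act_disk_apply (a : ZMod 2) (P : 𝒜) [Projective P] (X : C₂P 𝒜) (f : invariants 𝒜) :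
    (act (isoClass (diskP a P)) f).1 (isoClass X) = diskScalar a P X * f.1 (isoClass X) := by
  have h₁ := sqrtCard_ne_zero (P ⟶ X.obj.X a)
  have h₂ := sqrtCard_ne_zero (P ⟶ X.obj.X (a + 1))
  have h₃ := sqrtCard_ne_zero (X.obj.X (a + 1) ⟶ P)
  rw [act_isoClass_apply, hallSum_disk_right, ← mem_invariants_iff.1 f.2 a P X, diskScalar,
    smul_eq_mul]
  field_simp

lemma isUnit_act_disk (a : ZMod 2) (P : 𝒜) [Projective P] :
    IsUnit (act (isoClass (diskP a P))) := by
  rw [Module.End.isUnit_iff]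
  refine ⟨(injective_iff_map_eq_zero _).2 fun f hf => ?_, fun f => ?_⟩
  · ext c
    induction c using Quotient.inductionOn with | _ X
    have h := act_disk_apply a P X f
    rw [hf] at h
    exact (mul_eq_zero.1 h.symm).resolve_left (diskScalar_ne_zero a P X)
  · let g (c : IsoClass (C₂P 𝒜)) : ℂ := (diskScalar a P c.out)⁻¹ * f.1 c
    have hg (X : C₂P 𝒜) : g (isoClass X) = (diskScalar a P X)⁻¹ * f.1 (isoClass X) := by
      rw [← diskScalar_congr a P (nonempty_out_iso X).some]
    have g_mem : g ∈ invariants 𝒜 := by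
      rw [mem_invariants_iff]
      intro b Q _ X
      rw [hg, hg, diskScalar_sumP_disk, ← mem_invariants_iff.1 f.2 b Q X, mul_left_comm]
    refine ⟨⟨g, g_mem⟩, Subtype.ext (funext fun c => ?_)⟩
    induction c using Quotient.inductionOn with | _ X
    refine (act_disk_apply a P X _).trans ((congrArg _ (hg X)).trans ?_)
    rw [mul_inv_cancel_left₀ (diskScalar_ne_zero a P X)]

lemma isUnit_act_sumP_disk (a b : ZMod 2) (P Q : 𝒜) [Projective P] [Projective Q] :
    IsUnit (act (isoClass (sumP (diskP a P) (diskP b Q)))) := by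
  have h := (isUnit_act_disk a P).mul (isUnit_act_disk b Q)
  rw [act_mul_act, hallSum_out_left, hallSum_out_right, hallSum_disk_left] at h
  exact (isUnit_smul_iff (Units.mk0 _
    (div_ne_zero (sqrtCard_ne_zero _) (sqrtCard_ne_zero _))) _).1 h

end Action

/-! ### Acyclic complexes of projectives -/

section Acyclic

variable {𝒜 : Type u} [Category.{v} 𝒜] [Abelian 𝒜]

/-- The sequence `0 ⟶ Ker d_i ⟶ K_i ⟶ Ker d_j ⟶ 0`, for consecutive differentials
`K_i ⟶ K_j ⟶ K_l`. -/
abbrev kernelSequence {ι : Type*} {c : ComplexShape ι} (K : HomologicalComplex 𝒜 c) (i j l : ι) :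
    ShortComplex 𝒜 :=
  ShortComplex.mk (kernel.ι (K.d i j)) (kernel.lift (K.d j l) (K.d i j) (K.d_comp_d i j l)) <| by
    simp [← cancel_mono (kernel.ι (K.d j l))]

lemma shortExact_kernelSequence {ι : Type*} {c : ComplexShape ι} {K : HomologicalComplex 𝒜 c}
    {i j l : ι} (hij : c.Rel i j) (hjl : c.Rel j l) (hK : K.ExactAt j) :
    (kernelSequence K i j l).ShortExact := by
  have h : (K.sc' i j l).Exact :=
    (K.exactAt_iff' _ _ _ (c.prev_eq' hij) (c.next_eq' hjl)).1 hK
  have : Epi (kernelSequence K i j l).g := (ShortComplex.exact_iff_epi_kernel_lift _).1 h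
  refine ShortComplex.ShortExact.mk' ?_ inferInstance this
  refine ShortComplex.exact_of_f_is_kernel _ <| KernelFork.IsLimit.ofι' _ _ fun {A} t ht =>
    ⟨kernel.lift _ t ?_, kernel.lift_ι _ _ _⟩
  simpa [kernelSequence] using congrArg (· ≫ kernel.ι _) ht

lemma projective_kernel_d (hgl : HasFiniteGlobalDimension 𝒜) {K : C₂ 𝒜} (hK : K.Acyclic)
    (hP : ∀ i, Projective (K.X i)) (i : ZMod 2) : Projective (kernel (K.d i (i + 1))) := by
  obtain ⟨d, hd⟩ := hgl
  have dim_le_of_le_succ (n : ℕ)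
      (h : ∀ i, HasProjectiveDimensionLT (kernel (K.d i (i + 1))) (n + 1 + 1)) (i : ZMod 2) :
      HasProjectiveDimensionLT (kernel (K.d i (i + 1))) (n + 1) := by
    have := hP i
    exact (shortExact_kernelSequence rfl rfl (hK (i + 1))).hasProjectiveDimensionLT_X₁ (n + 1)
      (inferInstanceAs (HasProjectiveDimensionLT (K.X i) (n + 1))) (h (i + 1))
  have projective_of_dim_le (n : ℕ)
      (h : ∀ i, HasProjectiveDimensionLT (kernel (K.d i (i + 1))) (n + 1)) (i : ZMod 2) :
      Projective (kernel (K.d i (i + 1))) := by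
    induction n with
    | zero => exact projective_iff_hasProjectiveDimensionLT_one.2 (h i)
    | succ n ih => exact ih (dim_le_of_le_succ n h)
  exact projective_of_dim_le d (fun _ => hd _) i

/-- The morphism from a disk complex given by a morphism in its first degree. -/
def fromDisk {a b : ZMod 2} (h : a + 1 = b) {P : 𝒜} {K : C₂ 𝒜} (g : P ⟶ K.X a) :
    diskComplex a P ⟶ K where
  f := Function.update (fun j => g ≫ K.d a j) a g
  comm' i j hij := by
    obtain rfl : i + 1 = j := hij
    obtain rfl | rfl := zmod_two_cases a i <;> simp [diskComplex]

/-- The morphism to a disk complex given by a morphism in its second degree. -/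
def toDisk {a b : ZMod 2} (h : a + 1 = b) {P : 𝒜} {K : C₂ 𝒜} (g : K.X b ⟶ P) :
    K ⟶ diskComplex a P where
  f := Function.update (fun j => K.d j b ≫ g) b g
  comm' i j hij := by
    obtain rfl : i + 1 = j := hij
    subst h
    obtain rfl | rfl := zmod_two_cases a i <;> simp [diskComplex]

section Disk

variable {a b : ZMod 2} (h : a + 1 = b) {P : 𝒜} {K : C₂ 𝒜}

lemma fromDisk_f_left (g : P ⟶ K.X a) : (fromDisk h g).f a = g :=
  Function.update_self (β := fun j => P ⟶ K.X j) a g fun j => g ≫ K.d a j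

lemma fromDisk_f_right (g : P ⟶ K.X a) : (fromDisk h g).f b = g ≫ K.d a b :=
  Function.update_of_ne (β := fun j => P ⟶ K.X j) (h ▸ zmod_two_add_one_ne a) g
    fun j => g ≫ K.d a j

lemma toDisk_f_left (g : K.X b ⟶ P) : (toDisk h g).f a = K.d a b ≫ g :=
  Function.update_of_ne (β := fun j => K.X j ⟶ P) (h ▸ (zmod_two_add_one_ne a).symm) g
    fun j => K.d j b ≫ g

lemma toDisk_f_right (g : K.X b ⟶ P) : (toDisk h g).f b = g :=
  Function.update_self (β := fun j => K.X j ⟶ P) b g fun j => K.d j b ≫ g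

end Disk

/-- Splittings of the two sequences of kernels exhibit `K` as an extension of a disk complex by a
disk complex, and such an extension is trivial. -/
lemma nonempty_iso_sum_disk {a b : ZMod 2} (hab : a + 1 = b) (hba : b + 1 = a) (K : C₂ 𝒜)
    (σa : (kernelSequence K a b a).Splitting) (σb : (kernelSequence K b a b).Splitting) :
    Nonempty ((0 : Cocycle (diskComplex b (kernel (K.d a b)))
      (diskComplex a (kernel (K.d b a)))).twist ≅ K) := by
  let i : diskComplex a (kernel (K.d b a)) ⟶ K := fromDisk hab σa.s
  let p : K ⟶ diskComplex b (kernel (K.d a b)) := toDisk hba σa.r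
  have s_d : σa.s ≫ K.d a b = kernel.ι (K.d b a) := by
    simpa using congrArg (· ≫ kernel.ι (K.d b a)) σa.s_g
  have d_r : K.d b a ≫ σa.r = kernel.lift (K.d a b) (K.d b a) (K.d_comp_d b a b) := by
    simpa using congrArg (kernel.lift (K.d a b) (K.d b a) (K.d_comp_d b a b) ≫ ·) σa.f_r
  have ia : i.f a = σa.s := fromDisk_f_left hab σa.s
  have pa : p.f a = σa.r := toDisk_f_right hba σa.r
  have ib : i.f b = kernel.ι (K.d b a) := (fromDisk_f_right hab σa.s).trans s_d
  have pb : p.f b = kernel.lift (K.d a b) (K.d b a) (K.d_comp_d b a b) :=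
    (toDisk_f_left hba σa.r).trans d_r
  have splits (j : ZMod 2) : ∃ w : i.f j ≫ p.f j = 0,
      Nonempty (ShortComplex.mk (i.f j) (p.f j) w).Splitting := by
    obtain rfl | rfl : j = a ∨ j = b := hab ▸ zmod_two_cases a j
    · rw [ia, pa]
      exact ⟨σa.s_r, ⟨{
        r := (kernelSequence K j b j).g
        s := (kernelSequence K j b j).f
        f_r := σa.s_g
        s_g := σa.f_r
        id := (add_comm _ _).trans σa.id }⟩⟩
    · rw [ib, pb]
      exact ⟨(kernelSequence K j a j).zero, ⟨σb⟩⟩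
  choose w σ using splits
  have := isIso_diskComplex_d a (kernel (K.d b a))
  obtain ⟨s, hs⟩ := (Cocycle.bijective_δ_single_of_isIso_target a
    (diskComplex a (kernel (K.d b a))) (diskComplex b (kernel (K.d a b)))).surjective
      (Cocycle.ofSplitting fun j => (σ j).some)
  exact ⟨(Cocycle.twistδ _).symm ≪≫ eqToIso (congrArg Cocycle.twist hs) ≪≫
    Cocycle.twistOfSplittingIso _⟩

theorem exists_iso_sumP_disk (hgl : HasFiniteGlobalDimension 𝒜) {K : C₂P 𝒜} (hK : K.obj.Acyclic) :
    ∃ (P Q : 𝒜) (_ : Projective P) (_ : Projective Q),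
      Nonempty ((sumP (diskP 1 P) (diskP 0 Q)).obj ≅ K.obj) := by
  have hP₀ : Projective (kernel (K.obj.d 0 1)) := projective_kernel_d hgl hK K.property 0
  have hP₁ : Projective (kernel (K.obj.d 1 0)) := projective_kernel_d hgl hK K.property 1
  have h₀ : (kernelSequence K.obj 0 1 0).ShortExact := shortExact_kernelSequence rfl rfl (hK 1)
  have h₁ : (kernelSequence K.obj 1 0 1).ShortExact := shortExact_kernelSequence rfl rfl (hK 0)
  have : Projective (kernelSequence K.obj 0 1 0).X₃ := hP₁
  have : Projective (kernelSequence K.obj 1 0 1).X₃ := hP₀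
  exact ⟨_, _, hP₀, hP₁, nonempty_iso_sum_disk rfl rfl K.obj h₀.splittingOfProjective
    h₁.splittingOfProjective⟩

end Acyclic

/-! ### Functionals which detect the homology in degree zero -/

section TestFunctions

variable {𝒜 : Type u} [Category.{v} 𝒜] [Abelian 𝒜]

instance {ι : Type*} (c : ComplexShape ι) (i : ι) :
    (HomologicalComplex.opcyclesFunctor 𝒜 c i).Additive :=
  ⟨fun {_ _ _ _} => ShortComplex.opcyclesMap_add
    (φ := (HomologicalComplex.shortComplexFunctor 𝒜 c i).map _)
    (φ' := (HomologicalComplex.shortComplexFunctor 𝒜 c i).map _)⟩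

/-- The extension given by the zero cocycle, with its structure of a direct sum. -/
@[simps]
def sumBicone {ι : Type*} {c : ComplexShape ι} (M N : HomologicalComplex 𝒜 c) :
    BinaryBicone N M where
  pt := (0 : Cocycle M N).twist
  fst := { f := Cocycle.fst 0 }
  snd := Cocycle.projection 0
  inl := Cocycle.inclusion 0
  inr := { f := Cocycle.inr 0 }

/-- An additive functor takes the extension given by the zero cocycle to a direct sum. -/
def mapSumIso {ι : Type*} {c : ComplexShape ι} (F : HomologicalComplex 𝒜 c ⥤ 𝒜) [F.Additive]
    (M N : HomologicalComplex 𝒜 c) :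
    F.obj (0 : Cocycle M N).twist ≅ F.obj N ⊞ F.obj M :=
  have total : (sumBicone M N).fst ≫ (sumBicone M N).inl +
      (sumBicone M N).snd ≫ (sumBicone M N).inr = 𝟙 _ := by
    ext i
    exact Cocycle.total 0 i
  have := preservesBinaryBiproducts_of_preservesBiproducts F
  biprod.uniqueUpToIso _ _ (isBinaryBilimitOfPreserves F (isBinaryBilimitOfTotal _ total))

lemma sqrtCard_biprod_hom (X Y Z : 𝒜) :
    sqrtCard (X ⊞ Y ⟶ Z) = sqrtCard (X ⟶ Z) * sqrtCard (Y ⟶ Z) :=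
  (sqrtCard_congr
    { toFun g := (biprod.inl ≫ g, biprod.inr ≫ g)
      invFun g := biprod.desc g.1 g.2
      left_inv g := by ext <;> simp
      right_inv g := by ext <;> simp }).trans sqrtCard_prod

lemma isIso_pOpcycles_diskComplex (a : ZMod 2) (P : 𝒜) :
    IsIso ((diskComplex a P).pOpcycles a) := by
  refine (diskComplex a P).isIso_pOpcycles (a + 1) a
    (ComplexShape.prev_eq' _ (zmod_two_add_one_add_one a)) ?_
  exact if_neg (by simp)

lemma isZero_opcycles_diskComplex (a : ZMod 2) (P : 𝒜) :
    IsZero ((diskComplex a P).opcycles (a + 1)) := by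
  have := isIso_diskComplex_d a P
  rw [IsZero.iff_id_eq_zero, ← cancel_epi ((diskComplex a P).pOpcycles (a + 1)),
    ← cancel_epi ((diskComplex a P).d a (a + 1))]
  simp

/-- The factor in degree `i` of `opcyclesWeight`. -/
def opcyclesRatio (X : C₂ 𝒜) (i : ZMod 2) : ℂ :=
  sqrtCard (X.opcycles i ⟶ X.X i) / sqrtCard (X.opcycles i ⟶ X.X (i + 1))

lemma opcyclesRatio_congr {X Y : C₂ 𝒜} (e : X ≅ Y) (i : ZMod 2) :
    opcyclesRatio X i = opcyclesRatio Y i := by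
  have h (j : ZMod 2) : sqrtCard (X.opcycles i ⟶ X.X j) = sqrtCard (Y.opcycles i ⟶ Y.X j) :=
    sqrtCard_congr (Iso.homCongr ((HomologicalComplex.opcyclesFunctor 𝒜 _ i).mapIso e)
      ((HomologicalComplex.eval 𝒜 _ j).mapIso e))
  rw [opcyclesRatio, opcyclesRatio, h, h]

lemma sqrtCard_opcycles_sum (M N : C₂ 𝒜) (i j : ZMod 2) :
    sqrtCard ((0 : Cocycle M N).twist.opcycles i ⟶ (0 : Cocycle M N).twist.X j) =
      sqrtCard (N.opcycles i ⟶ N.X j) * sqrtCard (N.opcycles i ⟶ M.X j) *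
        (sqrtCard (M.opcycles i ⟶ N.X j) * sqrtCard (M.opcycles i ⟶ M.X j)) := by
  let e : (0 : Cocycle M N).twist.opcycles i ≅ N.opcycles i ⊞ M.opcycles i :=
    mapSumIso (HomologicalComplex.opcyclesFunctor 𝒜 _ i) M N
  have h (Y : 𝒜) : sqrtCard (Y ⟶ (0 : Cocycle M N).twist.X j) =
      sqrtCard (Y ⟶ N.X j) * sqrtCard (Y ⟶ M.X j) :=
    (sqrtCard_congr (Cocycle.homTwistEquiv 0 j Y)).trans sqrtCard_prod
  rw [sqrtCard_congr (e.homCongr (Iso.refl _)), sqrtCard_biprod_hom, h, h]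

/-- A weight of complexes which changes under the addition of a disk complex as required by
`mem_invariants_iff`. -/
def opcyclesWeight (X : C₂ 𝒜) : ℂ := ∏ i, opcyclesRatio X i

lemma opcyclesWeight_eq (X : C₂ 𝒜) (a : ZMod 2) :
    opcyclesWeight X = opcyclesRatio X a * opcyclesRatio X (a + 1) :=
  Fintype.prod_eq_mul a (a + 1) (zmod_two_add_one_ne a).symm fun i hi =>
    ((zmod_two_cases a i).elim hi.1 hi.2).elim

open Classical in
/-- The functional which detects the complexes with homology `M` in degree zero. -/
def homologyTest (M : 𝒜) (c : IsoClass (C₂P 𝒜)) : ℂ :=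
  if Nonempty (c.out.obj.homology 0 ≅ M) then opcyclesWeight c.out.obj else 0

open Classical in
lemma homologyTest_isoClass (M : 𝒜) (X : C₂P 𝒜) : homologyTest M (isoClass X) =
    if Nonempty (X.obj.homology 0 ≅ M) then opcyclesWeight X.obj else 0 := by
  obtain ⟨e⟩ := nonempty_out_iso X
  let e₀ := (HomologicalComplex.homologyFunctor 𝒜 _ 0).mapIso e
  have h : Nonempty ((isoClass X).out.obj.homology 0 ≅ M) ↔ Nonempty (X.obj.homology 0 ≅ M) :=
    ⟨fun ⟨t⟩ => ⟨e₀.symm ≪≫ t⟩, fun ⟨t⟩ => ⟨e₀ ≪≫ t⟩⟩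
  simp only [homologyTest, h, opcyclesWeight, opcyclesRatio_congr e]

section Finite

variable [∀ X Y : 𝒜, Finite (X ⟶ Y)]

lemma opcyclesWeight_ne_zero (X : C₂ 𝒜) : opcyclesWeight X ≠ 0 :=
  Finset.prod_ne_zero_iff.2 fun _ _ => div_ne_zero (sqrtCard_ne_zero _) (sqrtCard_ne_zero _)

lemma opcyclesRatio_sum_disk_self (X : C₂ 𝒜) (a : ZMod 2) (P : 𝒜) :
    opcyclesRatio (0 : Cocycle (diskComplex a P) X).twist a =
      opcyclesRatio X a * (sqrtCard (P ⟶ X.X a) / sqrtCard (P ⟶ X.X (a + 1))) := by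
  have := isIso_pOpcycles_diskComplex a P
  have h (Y : 𝒜) : sqrtCard ((diskComplex a P).opcycles a ⟶ Y) = sqrtCard (P ⟶ Y) :=
    sqrtCard_congr ((asIso ((diskComplex a P).pOpcycles a)).homCongr (Iso.refl Y)).symm
  have hX (i : ZMod 2) : (diskComplex a P).X i = P := rfl
  have h₁ := sqrtCard_ne_zero (X.opcycles a ⟶ P)
  have h₂ := sqrtCard_ne_zero (P ⟶ P)
  simp only [opcyclesRatio, sqrtCard_opcycles_sum, h, hX]
  field_simp

lemma opcyclesRatio_sum_disk_add_one (X : C₂ 𝒜) (a : ZMod 2) (P : 𝒜) :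
    opcyclesRatio (0 : Cocycle (diskComplex a P) X).twist (a + 1) =
      opcyclesRatio X (a + 1) := by
  have h (Y : 𝒜) : sqrtCard ((diskComplex a P).opcycles (a + 1) ⟶ Y) = 1 := by
    have : Unique ((diskComplex a P).opcycles (a + 1) ⟶ Y) :=
      ⟨⟨0⟩, fun g => (isZero_opcycles_diskComplex a P).eq_of_src g 0⟩
    exact sqrtCard_of_unique
  have hX (i : ZMod 2) : (diskComplex a P).X i = P := rfl
  have h₁ := sqrtCard_ne_zero (X.opcycles (a + 1) ⟶ P)
  simp only [opcyclesRatio, sqrtCard_opcycles_sum, h, hX]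
  field_simp

lemma homologyTest_ne_zero_iff {M : 𝒜} {X : C₂P 𝒜} :
    homologyTest M (isoClass X) ≠ 0 ↔ Nonempty (X.obj.homology 0 ≅ M) := by
  classical
  rw [homologyTest_isoClass, ite_ne_right_iff, and_iff_left (opcyclesWeight_ne_zero _)]

lemma homologyTest_mem_invariants (M : 𝒜) : homologyTest M ∈ invariants 𝒜 := by
  classical
  rw [mem_invariants_iff]
  intro a P _ X
  have hD : IsZero ((diskComplex a P).homology 0) := (diskComplex_acyclic a P 0).isZero_homology
  let e : (sumP (diskP a P) X).obj.homology 0 ≅ X.obj.homology 0 :=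
    mapSumIso (HomologicalComplex.homologyFunctor 𝒜 _ 0) _ _ ≪≫ (isoBiprodZero hD).symm
  have h : Nonempty ((sumP (diskP a P) X).obj.homology 0 ≅ M) ↔
      Nonempty (X.obj.homology 0 ≅ M) :=
    ⟨fun ⟨t⟩ => ⟨e.symm ≪≫ t⟩, fun ⟨t⟩ => ⟨e ≪≫ t⟩⟩
  have hw : opcyclesWeight (sumP (diskP a P) X).obj =
      opcyclesWeight X.obj * (sqrtCard (P ⟶ X.obj.X a) / sqrtCard (P ⟶ X.obj.X (a + 1))) := by
    rw [opcyclesWeight_eq _ a, opcyclesWeight_eq _ a, mul_right_comm]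
    exact congrArg₂ (· * ·) (opcyclesRatio_sum_disk_self X.obj a P)
      (opcyclesRatio_sum_disk_add_one X.obj a P)
  have h₁ := sqrtCard_ne_zero (P ⟶ X.obj.X a)
  have h₂ := sqrtCard_ne_zero (P ⟶ X.obj.X (a + 1))
  rw [homologyTest_isoClass, homologyTest_isoClass, if_congr h rfl rfl, hw, mul_ite, mul_zero]
  congr 1
  field_simp

end Finite

end TestFunctions

/-! ### The representation of Bridgeland's Hall algebra on the invariant functionals -/

section Representation

variable {𝒜 : Type u} [Category.{v} 𝒜] [Abelian 𝒜] [∀ X Y : 𝒜, Finite (X ⟶ Y)]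

lemma isUnit_act_of_acyclic (hgl : HasFiniteGlobalDimension 𝒜) {M : C₂P 𝒜}
    (hM : M.obj.Acyclic) : IsUnit (act (isoClass M)) := by
  obtain ⟨P, Q, _, _, he⟩ := exists_iso_sumP_disk hgl hM
  rw [← isoClass_eq_iff.2 he]
  exact isUnit_act_sumP_disk 1 0 P Q

variable (k : Type*) [Field k] [Linear k 𝒜]

/-- The action of the Hall algebra `H_tw(C₂(𝒫))` on the invariant functionals. -/
def hallRep : HallC₂P k 𝒜 →ₗ[ℂ] Module.End ℂ (invariants 𝒜) :=
  (HallC₂P.basis k 𝒜).constr ℂ act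

lemma hallRep_basis (c : IsoClass (C₂P 𝒜)) : hallRep k (HallC₂P.basis k 𝒜 c) = act c :=
  Module.Basis.constr_basis _ _ _ _

lemma hallRep_apply (x : HallC₂P k 𝒜) :
    hallRep k x = Finsupp.sum x fun c r => r • act c :=
  Module.Basis.constr_apply _ _ _ _

lemma hallRep_twistedHallProduct [Finite k] (a b : IsoClass (C₂P 𝒜)) :
    hallRep k (twistedHallProduct (fun c : IsoClass (C₂P 𝒜) => c.out.obj)
      (fun M N => vParam k ^ (eulerForm k (M.X 0) (N.X 0) + eulerForm k (M.X 1) (N.X 1))) a b) =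
    act a * act b := by
  have h_single (c : IsoClass (C₂P 𝒜)) : hallRep k (Finsupp.single c (1 : ℂ)) = act c :=
    (hallRep_apply k _).trans
      ((Finsupp.sum_single_index (zero_smul ℂ (act c))).trans (one_smul ℂ (act c)))
  rw [twistedHallProduct_eq_hallSum, act_mul_act]
  have h := map_hallSum (E := HallC₂P k 𝒜) (hallRep k) a.out b.out fun c => Finsupp.single c 1
  exact h.trans (congrArg (hallSum a.out b.out) (funext h_single))

lemma hallRep_mul [Finite k] (x y : HallC₂P k 𝒜) :
    hallRep k (x * y) = hallRep k x * hallRep k y := by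
  have h_expand : hallRep k (x * y) = Finsupp.sum x fun a r => Finsupp.sum y fun b s =>
      (r * s) • (act a * act b) := by
    refine (map_finsuppSum (hallRep k) x _).trans (Finsupp.sum_congr fun a _ => ?_)
    refine (map_finsuppSum (hallRep k) y _).trans (Finsupp.sum_congr fun b _ => ?_)
    exact (map_smul (hallRep k) _ _).trans (congrArg _ (hallRep_twistedHallProduct k a b))
  rw [h_expand, hallRep_apply, hallRep_apply]
  refine Eq.symm ((Finsupp.sum_mul _ _).trans (Finsupp.sum_congr fun a _ => ?_))
  exact (Finsupp.mul_sum _ _).trans (Finsupp.sum_congr fun b _ => smul_mul_smul_comm _ _ _ _)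

/-- The action of the generators of `DH₂(𝒜)` on the invariant functionals. -/
def genRep : LocGen 𝒜 → Module.End ℂ (invariants 𝒜)
  | .cls c => act c
  | .inv M _ => Ring.inverse (act (isoClass M))

lemma lift_toFree (x : HallC₂P k 𝒜) :
    FreeAlgebra.lift ℂ genRep (toFree k 𝒜 x) = hallRep k x := by
  suffices (FreeAlgebra.lift ℂ genRep).toLinearMap ∘ₗ toFree k 𝒜 = hallRep k from
    LinearMap.congr_fun this x
  refine (HallC₂P.basis k 𝒜).ext fun c => ?_
  rw [hallRep_basis, LinearMap.comp_apply, toFree, Module.Basis.constr_basis]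
  exact FreeAlgebra.lift_ι_apply _ _

variable [Finite k] (hgl : HasFiniteGlobalDimension 𝒜)

/-- The representation of `DH₂(𝒜)` on the invariant functionals. -/
def rep : DH₂ k 𝒜 →ₐ[ℂ] Module.End ℂ (invariants 𝒜) :=
  RingQuot.liftAlgHom ℂ ⟨FreeAlgebra.lift ℂ genRep, fun x y h => by
    cases h with
    | mul x y => rw [map_mul, lift_toFree, lift_toFree, lift_toFree, hallRep_mul]
    | one Z hZ => rw [lift_toFree, hallRep_basis, map_one, act_of_isZero Z hZ]
    | mul_inv M hM =>
      rw [map_mul, lift_toFree, hallRep_basis, map_one, FreeAlgebra.lift_ι_apply]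
      exact Ring.mul_inverse_cancel _ (isUnit_act_of_acyclic hgl hM)
    | inv_mul M hM =>
      rw [map_mul, lift_toFree, hallRep_basis, map_one, FreeAlgebra.lift_ι_apply]
      exact Ring.inverse_mul_cancel _ (isUnit_act_of_acyclic hgl hM)⟩

lemma rep_cls (M : C₂P 𝒜) : rep k hgl (DH₂.cls k M) = act (isoClass M) := by
  rw [← hallRep_basis k, ← lift_toFree]
  exact RingQuot.liftAlgHom_mkAlgHom_apply ℂ _ _ _

end Representation

/-! ### Linear independence -/

section LinearIndependence

open ZeroObject in
/-- The zero complex as an object of `C₂(𝒫)`. -/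
def zeroP (𝒜 : Type u) [Category.{v} 𝒜] [Abelian 𝒜] : C₂P 𝒜 := ⟨0, fun i =>
  ((HomologicalComplex.eval 𝒜 _ i).map_isZero (isZero_zero (C₂ 𝒜))).projective⟩

variable {𝒜 : Type u} [Category.{v} 𝒜] [Abelian 𝒜] (k : Type*) [Field k] [Linear k 𝒜]

section Finite

variable [∀ X Y : 𝒜, Finite (X ⟶ Y)] [Finite k] (hgl : HasFiniteGlobalDimension 𝒜)

/-- The pairing of `DH₂(𝒜)` with the invariant functionals, extending `⟨f, [M]⟩ = f([M])`. -/
def pairing (f : invariants 𝒜) : Module.Dual ℂ (DH₂ k 𝒜) :=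
  LinearMap.proj (isoClass (zeroP 𝒜)) ∘ₗ (invariants 𝒜).subtype ∘ₗ LinearMap.applyₗ f ∘ₗ
    (rep k hgl).toLinearMap

lemma pairing_cls (f : invariants 𝒜) (M : C₂P 𝒜) :
    pairing k hgl f (DH₂.cls k M) = f.1 (isoClass M) :=
  (congrArg (fun φ : Module.End ℂ (invariants 𝒜) => (φ f).1 _) (rep_cls k hgl M)).trans
    (act_apply_of_isZero _ _ (isZero_zero (C₂ 𝒜)) f)

/-- The units of `DH₂(𝒜)` whose left multiplication rescales the pairing. -/
def scalingUnits : Subgroup (DH₂ k 𝒜)ˣ where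
  carrier := {x | ∃ r : ℂ, r ≠ 0 ∧ ∀ f y, pairing k hgl f (x * y) = r * pairing k hgl f y}
  one_mem' := ⟨1, one_ne_zero, fun f y => by rw [Units.val_one, one_mul, one_mul]⟩
  mul_mem' := by
    rintro x x' ⟨r, hr, h⟩ ⟨r', hr', h'⟩
    exact ⟨r * r', mul_ne_zero hr hr', fun f y => by
      rw [Units.val_mul, mul_assoc, h, h', mul_assoc]⟩
  inv_mem' := by
    rintro x ⟨r, hr, h⟩
    exact ⟨r⁻¹, inv_ne_zero hr, fun f y => by
      rw [eq_inv_mul_iff_mul_eq₀ hr, ← h, Units.mul_inv_cancel_left]⟩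

lemma unit_disk_mem_scalingUnits (a : ZMod 2) (P : 𝒜) [Projective P] :
    DH₂.unit k (diskP a P) (diskComplex_acyclic a P) ∈ scalingUnits k hgl := by
  refine ⟨diskScalar a P (zeroP 𝒜), diskScalar_ne_zero _ _ _, fun f y => ?_⟩
  have h : rep k hgl (DH₂.cls k (diskP a P) * y) f =
      act (isoClass (diskP a P)) (rep k hgl y f) := by
    rw [map_mul, rep_cls, Module.End.mul_apply]
  exact (congrArg (fun g : invariants 𝒜 => g.1 _) h).trans (act_disk_apply a P _ _)

lemma elemK_mem_scalingUnits (α : GrothendieckK 𝒜) : elemK k α ∈ scalingUnits k hgl := by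
  rw [elemK]
  split_ifs with h
  · have := h.choose_spec.1
    have := h.choose_spec.2.1
    exact mul_mem (unit_disk_mem_scalingUnits k hgl 1 _)
      (inv_mem (unit_disk_mem_scalingUnits k hgl 1 _))
  · exact one_mem _

lemma elemKStar_mem_scalingUnits (α : GrothendieckK 𝒜) :
    elemKStar k α ∈ scalingUnits k hgl := by
  rw [elemKStar]
  split_ifs with h
  · have := h.choose_spec.1
    have := h.choose_spec.2.1
    exact mul_mem (unit_disk_mem_scalingUnits k hgl 0 _)
      (inv_mem (unit_disk_mem_scalingUnits k hgl 0 _))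
  · exact one_mem _

lemma exists_pairing_elemE {M : 𝒜} (P : FiniteResolution M) :
    ∃ r : ℂ, r ≠ 0 ∧ ∀ f : invariants 𝒜,
      pairing k hgl f (P.elemE k) = r * f.1 (isoClass P.foldedComplex) := by
  obtain ⟨r, hr, h⟩ := mul_mem (elemK_mem_scalingUnits k hgl (-kClass P.oddPart))
    (elemKStar_mem_scalingUnits k hgl (-kClass P.evenPart))
  refine ⟨vParam k ^ (eulerForm k P.oddPart M - eulerForm k P.evenPart M) * r,
    mul_ne_zero (zpow_ne_zero _ (vParam_ne_zero k)) hr, fun f => ?_⟩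
  rw [FiniteResolution.elemE, map_smul, ← Units.val_mul, h, pairing_cls, smul_eq_mul, mul_assoc]

lemma pairing_homologyTest_elemE_ne_zero_iff (M : 𝒜) {N : 𝒜} (P : FiniteResolution N) :
    pairing k hgl ⟨homologyTest M, homologyTest_mem_invariants M⟩ (P.elemE k) ≠ 0 ↔
      Nonempty (P.foldedComplex.obj.homology 0 ≅ M) := by
  obtain ⟨r, hr, h⟩ := exists_pairing_elemE k hgl P
  rw [h, mul_ne_zero_iff, and_iff_right hr, homologyTest_ne_zero_iff]

theorem linearIndependent_elemE (hgl : HasFiniteGlobalDimension 𝒜)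
    (R : ∀ M : 𝒜, FiniteResolution M)
    (hR : ∀ M, Nonempty ((R M).foldedComplex.obj.homology 0 ≅ M)) :
    LinearIndependent ℂ (fun c : IsoClass 𝒜 => (R c.out).elemE k) := by
  let φ (c : IsoClass 𝒜) : Module.Dual ℂ (DH₂ k 𝒜) :=
    pairing k hgl ⟨homologyTest c.out, homologyTest_mem_invariants c.out⟩
  have hφ (b c : IsoClass 𝒜) : φ c ((R b.out).elemE k) ≠ 0 ↔ b = c := by
    obtain ⟨e⟩ := hR b.out
    rw [pairing_homologyTest_elemE_ne_zero_iff, ← Quotient.out_equiv_out]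
    exact ⟨fun ⟨t⟩ => ⟨e.symm ≪≫ t⟩, fun ⟨t⟩ => ⟨e ≪≫ t⟩⟩
  exact .of_pairwise_dual_eq_zero_one _ (fun c => (φ c ((R c.out).elemE k))⁻¹ • φ c)
    (fun c b h => mul_eq_zero_of_right _ (not_not.1 fun h' => h.symm ((hφ b c).1 h')))
    fun c => inv_mul_cancel₀ ((hφ c c).2 rfl)

end Finite

lemma phi_injective {R : ∀ M : 𝒜, FiniteResolution M}
    (h : LinearIndependent ℂ (fun c : IsoClass 𝒜 => (R c.out).elemE k)) :
    Function.Injective (phi k R) := by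
  intro x y hxy
  rw [phi, Module.Basis.constr_apply, Module.Basis.constr_apply] at hxy
  exact (RingelHall.basis k 𝒜).repr.injective (h hxy)

end LinearIndependence

/-! ### The homology of folded resolutions -/

section Fold

variable {𝒜 : Type u} [Category.{v} 𝒜] [Abelian 𝒜]

lemma nonempty_homology_iso_of_projective [EnoughProjectives 𝒜] (S : ShortComplex 𝒜) {M : 𝒜}
    (π : S.X₂ ⟶ M) (hπ : S.f ≫ π = 0)
    (h_surj : ∀ ⦃T : 𝒜⦄ [Projective T] (y : T ⟶ M), ∃ x : T ⟶ S.X₂, x ≫ S.g = 0 ∧ x ≫ π = y)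
    (h_exact : ∀ ⦃T : 𝒜⦄ [Projective T] (x : T ⟶ S.X₂), x ≫ S.g = 0 → x ≫ π = 0 →
      ∃ z : T ⟶ S.X₁, z ≫ S.f = x) :
    Nonempty (S.homology ≅ M) := by
  have w : kernel.lift S.g S.f S.zero ≫ kernel.ι S.g ≫ π = 0 := by simp [hπ]
  have exact_w : (ShortComplex.mk _ _ w).Exact := by
    rw [ShortComplex.exact_iff_exact_up_to_refinements]
    intro T x hx
    obtain ⟨z, hz⟩ := h_exact (Projective.π T ≫ x ≫ kernel.ι S.g) (by simp) (by simp [hx])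
    exact ⟨_, Projective.π T, inferInstance, z, by simp [← cancel_mono (kernel.ι S.g), hz]⟩
  have epi_w : Epi (kernel.ι S.g ≫ π) := by
    rw [epi_iff_surjective_up_to_refinements]
    intro T y
    obtain ⟨x, hx, hxy⟩ := h_surj (Projective.π T ≫ y)
    exact ⟨_, Projective.π T, inferInstance, kernel.lift _ x hx, by simp [hxy]⟩
  exact ⟨ShortComplex.LeftHomologyData.homologyIso
    { K := kernel S.g
      H := M
      i := kernel.ι S.g
      π := kernel.ι S.g ≫ π
      wi := kernel.condition _
      hi := kernelIsKernel _
      wπ := w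
      hπ := exact_w.gIsCokernel }⟩

section Components

variable (P : ChainComplex 𝒜 ℕ) (n : ℕ) (j : ZMod 2)

/-- The morphism to the folded complex with components `w i`, for `i ≤ n` of parity `j`. -/
def foldLift {T : 𝒜} (w : ∀ i, T ⟶ P.X i) : T ⟶ (fold P n).X j :=
  biproduct.lift fun i : {i : Fin (n + 1) // ((i : ℕ) : ZMod 2) = j} => w (i.1 : ℕ)

/-- The projection from the folded complex to its component `P.X i`. -/
def foldProj (i : ℕ) (hi : i ≤ n) (hj : (i : ZMod 2) = j) : (fold P n).X j ⟶ P.X i :=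
  biproduct.π (fun i : {i : Fin (n + 1) // ((i : ℕ) : ZMod 2) = j} => P.X (i.1 : ℕ))
    ⟨⟨i, Nat.lt_succ_of_le hi⟩, hj⟩

variable {P n j} {T : 𝒜}

lemma foldLift_foldProj (w : ∀ i, T ⟶ P.X i) {i : ℕ} (hi : i ≤ n) (hj : (i : ZMod 2) = j) :
    foldLift P n j w ≫ foldProj P n j i hi hj = w i :=
  biproduct.lift_π _ _

lemma fold_hom_ext {x y : T ⟶ (fold P n).X j}
    (h : ∀ i hi hj, x ≫ foldProj P n j i hi hj = y ≫ foldProj P n j i hi hj) : x = y :=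
  biproduct.hom_ext _ _ fun i => h (i.1 : ℕ) (Nat.le_of_lt_succ i.1.2) i.2

lemma exists_foldLift_eq (x : T ⟶ (fold P n).X j) :
    ∃ w : ∀ i, T ⟶ P.X i, foldLift P n j w = x ∧ ∀ i : ℕ, (i : ZMod 2) ≠ j → w i = 0 := by
  refine ⟨fun i => if h : i ≤ n ∧ (i : ZMod 2) = j then x ≫ foldProj P n j i h.1 h.2 else 0,
    fold_hom_ext fun i hi hj => ?_, fun i hi => dif_neg fun h => hi h.2⟩
  rw [foldLift_foldProj, dif_pos ⟨hi, hj⟩]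

lemma foldLift_d (hP : ∀ i, n < i → IsZero (P.X i)) (w : ∀ i, T ⟶ P.X i) {j' : ZMod 2}
    (hj' : j + 1 = j') :
    foldLift P n j w ≫ (fold P n).d j j' =
      foldLift P n j' fun i => w (i + 1) ≫ P.d (i + 1) i := by
  refine fold_hom_ext fun i hi hj => ?_
  have h_matrix : (foldLift P n j w ≫ (fold P n).d j j') ≫ foldProj P n j' i hi hj =
      ∑ l : {l : Fin (n + 1) // ((l : ℕ) : ZMod 2) = j}, w l.1 ≫ P.d l.1 i := by
    change (biproduct.lift _ ≫ biproduct.matrix _) ≫ biproduct.π _ _ = _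
    rw [Category.assoc, biproduct.matrix_π, biproduct.lift_desc]
  have h_ne (l : ℕ) (hl : l ≠ i + 1) : w l ≫ P.d l i = 0 := by
    rw [P.shape _ _ fun h => hl h.symm, comp_zero]
  rw [foldLift_foldProj, h_matrix]
  by_cases hi' : i + 1 ≤ n
  · have h_parity : ((i + 1 : ℕ) : ZMod 2) = j := by
      push_cast
      rw [hj, ← hj', zmod_two_add_one_add_one]
    exact Fintype.sum_eq_single
      (⟨⟨i + 1, Nat.lt_succ_of_le hi'⟩, h_parity⟩ :
        {l : Fin (n + 1) // ((l : ℕ) : ZMod 2) = j})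
      fun l hl => h_ne _ fun h => hl (Subtype.ext (Fin.ext h))
  · rw [(hP (i + 1) (not_le.1 hi')).eq_of_src (P.d (i + 1) i) 0, comp_zero]
    exact Finset.sum_eq_zero fun l _ => h_ne _ (by omega)

lemma comp_d_eq_zero_of_foldLift_d_eq_zero (hP : ∀ i, n < i → IsZero (P.X i))
    {w : ∀ i, T ⟶ P.X i} (hw : ∀ i : ℕ, (i : ZMod 2) ≠ j → w i = 0) {j' : ZMod 2} (hj' : j + 1 = j')
    (h : foldLift P n j w ≫ (fold P n).d j j' = 0) (i : ℕ) : w (i + 1) ≫ P.d (i + 1) i = 0 := by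
  by_cases hi : n < i + 1
  · rw [(hP (i + 1) hi).eq_of_src (P.d _ _) 0, comp_zero]
  by_cases hij : ((i + 1 : ℕ) : ZMod 2) = j
  · have hi' : (i : ZMod 2) = j' := by
      rw [← hj', ← hij, Nat.cast_succ, zmod_two_add_one_add_one]
    rw [foldLift_d hP w hj'] at h
    rw [← foldLift_foldProj (fun i => w (i + 1) ≫ P.d (i + 1) i) (n := n) (by omega) hi', h,
      zero_comp]
  · rw [hw _ hij, zero_comp]

end Components

variable {M : 𝒜}

section Augmentation

variable (P : ProjectiveResolution M)

/-- The augmentation `P₀ ⟶ M` of a projective resolution, with target `M` itself rather than the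
degree `0` object of the complex concentrated in degree `0`. -/
def augmentation : P.complex.X 0 ⟶ M := P.π.f 0

instance epi_augmentation : Epi (augmentation P) := inferInstanceAs (Epi (P.π.f 0))

lemma d_augmentation : P.complex.d 1 0 ≫ augmentation P = 0 := P.complex_d_comp_π_f_zero

lemma exact_augmentation : (ShortComplex.mk _ _ (d_augmentation P)).Exact := P.exact₀

end Augmentation

variable (P : FiniteResolution M)

/-- The augmentation `(C_M)₀ ⟶ P₀ ⟶ M`. -/
def foldAug : (fold P.complex P.length).X 0 ⟶ M :=
  foldProj P.complex P.length 0 0 (Nat.zero_le _) rfl ≫ augmentation P.toProjectiveResolution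

lemma foldLift_foldAug {T : 𝒜} (w : ∀ i, T ⟶ P.complex.X i) :
    foldLift P.complex P.length 0 w ≫ foldAug P = w 0 ≫ augmentation P.toProjectiveResolution := by
  rw [foldAug, ← Category.assoc, foldLift_foldProj]

lemma fold_d_foldAug : (fold P.complex P.length).d 1 0 ≫ foldAug P = 0 := by
  obtain ⟨w, hw, -⟩ := exists_foldLift_eq (𝟙 ((fold P.complex P.length).X 1))
  rw [← Category.id_comp ((fold P.complex P.length).d 1 0), ← hw,
    foldLift_d P.isZero_of_gt w (j' := 0) (CharTwo.add_self_eq_zero 1), foldLift_foldAug,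
    Category.assoc, d_augmentation, comp_zero]

lemma exists_cycle_foldAug_eq {T : 𝒜} [Projective T] (y : T ⟶ M) :
    ∃ x : T ⟶ (fold P.complex P.length).X 0,
      x ≫ (fold P.complex P.length).d 0 1 = 0 ∧ x ≫ foldAug P = y := by
  let w : ∀ i, T ⟶ P.complex.X i
    | 0 => Projective.factorThru y (augmentation P.toProjectiveResolution)
    | _ + 1 => 0
  refine ⟨foldLift P.complex P.length 0 w, fold_hom_ext fun i hi hj => ?_, ?_⟩
  · rw [foldLift_d P.isZero_of_gt w (zero_add (1 : ZMod 2)), foldLift_foldProj, zero_comp,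
      zero_comp]
  · rw [foldLift_foldAug]
    exact Projective.factorThru_comp _ _

lemma exists_comp_fold_d_eq {T : 𝒜} [Projective T] {x : T ⟶ (fold P.complex P.length).X 0}
    (hx : x ≫ (fold P.complex P.length).d 0 1 = 0) (hx' : x ≫ foldAug P = 0) :
    ∃ z : T ⟶ (fold P.complex P.length).X 1, z ≫ (fold P.complex P.length).d 1 0 = x := by
  obtain ⟨w, rfl, hw⟩ := exists_foldLift_eq x
  rw [foldLift_foldAug] at hx'
  have hwd := comp_d_eq_zero_of_foldLift_d_eq_zero P.isZero_of_gt hw (zero_add (1 : ZMod 2)) hx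
  have h_exact := exact_augmentation P.toProjectiveResolution
  have h_lift : ∀ i, ∃ z : T ⟶ P.complex.X (i + 1), z ≫ P.complex.d (i + 1) i = w i
    | 0 => ⟨h_exact.liftFromProjective (w 0) hx', h_exact.liftFromProjective_comp _ _⟩
    | i + 1 => ⟨(P.exact_succ i).liftFromProjective (w (i + 1)) (hwd i),
        (P.exact_succ i).liftFromProjective_comp _ _⟩
  choose z hz using h_lift
  let z' : ∀ i, T ⟶ P.complex.X i
    | 0 => 0
    | i + 1 => z i
  refine ⟨foldLift P.complex P.length 1 z', ?_⟩
  rw [foldLift_d P.isZero_of_gt z' (j' := 0) (CharTwo.add_self_eq_zero 1)]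
  exact congrArg _ (funext hz)

lemma nonempty_homology_foldedComplex_iso [EnoughProjectives 𝒜] :
    Nonempty (P.foldedComplex.obj.homology 0 ≅ M) := by
  obtain ⟨e⟩ := nonempty_homology_iso_of_projective ((fold P.complex P.length).sc' 1 0 1)
    (foldAug P) (fold_d_foldAug P) (fun _ _ y => exists_cycle_foldAug_eq P y)
    fun _ _ _ hx hx' => exists_comp_fold_d_eq P hx hx'
  exact ⟨HomologicalComplex.homologyIsoSc' _ 1 0 1 (ComplexShape.prev_eq' _ rfl)
    (ComplexShape.next_eq' _ rfl) ≪≫ e⟩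

end Fold

/-! ### Existence of finite projective resolutions -/

section Resolutions

variable {𝒜 : Type u} [Category.{v} 𝒜] [Abelian 𝒜]

/-- An exact complex of projectives with an augmentation is a projective resolution. -/
def projectiveResolutionMk {M : 𝒜} (C : ChainComplex 𝒜 ℕ) (hC : ∀ n, Projective (C.X n))
    (p : C.X 0 ⟶ M) (hp : Epi p) (w : C.d 1 0 ≫ p = 0) (h₀ : (ShortComplex.mk _ _ w).Exact)
    (h : ∀ n, (ShortComplex.mk (C.d (n + 2) (n + 1)) (C.d (n + 1) n) (by simp)).Exact) :
    ProjectiveResolution M where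
  complex := C
  projective := hC
  π := (ChainComplex.toSingle₀Equiv _ _).symm ⟨p, w⟩
  quasiIso := ⟨fun
    | 0 => by
      rw [ChainComplex.quasiIsoAt₀_iff,
        ShortComplex.quasiIso_iff_of_zeros' _ (C.shape 0 0 (by simp)) rfl rfl]
      refine (ShortComplex.exact_and_epi_g_iff_of_iso ?_).2 ⟨h₀, hp⟩
      exact ShortComplex.isoMk (Iso.refl _) (Iso.refl _) (Iso.refl _)
        ((Category.id_comp _).trans (Category.comp_id _).symm)
        ((Category.id_comp p).trans <|
          (ChainComplex.toSingle₀Equiv_symm_apply_f_zero p w).symm.trans (Category.comp_id _).symm)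
    | n + 1 => by
      rw [quasiIsoAt_iff_exactAt' _ _ (ChainComplex.exactAt_succ_single_obj _ _),
        HomologicalComplex.exactAt_iff' _ (n + 2) (n + 1) n (by simp) (by simp)]
      exact h n⟩

lemma nonempty_finiteResolution_of_projective (M : 𝒜) [Projective M] :
    Nonempty (FiniteResolution M) :=
  ⟨{ toProjectiveResolution := ProjectiveResolution.self M
     length := 0
     isZero_of_gt := fun _ hi => HomologicalComplex.isZero_single_obj_X _ _ _ _ hi.ne' }⟩

lemma nonempty_finiteResolution_of_shortExact {S : ShortComplex 𝒜} (hS : S.ShortExact)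
    [Projective S.X₂] (Q : FiniteResolution S.X₁) : Nonempty (FiniteResolution S.X₃) := by
  have := hS.mono_f
  let ε : Q.complex.X 0 ⟶ S.X₁ := augmentation Q.toProjectiveResolution
  have : Epi ε := epi_augmentation Q.toProjectiveResolution
  have dε : Q.complex.d 1 0 ≫ ε = 0 := d_augmentation Q.toProjectiveResolution
  have dεf : Q.complex.d 1 0 ≫ ε ≫ S.f = 0 := by rw [reassoc_of% dε, zero_comp]
  have εfg : (ε ≫ S.f) ≫ S.g = 0 := by rw [Category.assoc, S.zero, comp_zero]
  have exact_εfg : (ShortComplex.mk _ _ εfg).Exact :=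
    let τ : ShortComplex.mk _ _ εfg ⟶ S := { τ₁ := ε, τ₂ := 𝟙 _, τ₃ := 𝟙 _ }
    (ShortComplex.exact_iff_of_epi_of_isIso_of_mono τ).2 hS.exact
  have exact_dεf : (ShortComplex.mk _ _ dεf).Exact :=
    let τ : ShortComplex.mk _ _ dε ⟶ ShortComplex.mk _ _ dεf := { τ₁ := 𝟙 _, τ₂ := 𝟙 _, τ₃ := S.f }
    (ShortComplex.exact_iff_of_epi_of_isIso_of_mono τ).1
      (exact_augmentation Q.toProjectiveResolution)
  exact ⟨{
    toProjectiveResolution :=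
      projectiveResolutionMk (ChainComplex.augment Q.complex (ε ≫ S.f) dεf)
        (fun | 0 => ‹Projective S.X₂› | n + 1 => Q.projective n) S.g hS.epi_g εfg exact_εfg
        (fun | 0 => exact_dεf | n + 1 => Q.exact_succ n)
    length := Q.length + 1
    isZero_of_gt := fun
      | 0, h => absurd h (Nat.not_lt_zero _)
      | i + 1, h => Q.isZero_of_gt i (Nat.lt_of_succ_lt_succ h) }⟩

lemma nonempty_finiteResolution_of_hasProjectiveDimensionLE [EnoughProjectives 𝒜] (n : ℕ) (M : 𝒜)
    (hM : HasProjectiveDimensionLE M n) : Nonempty (FiniteResolution M) := by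
  induction n generalizing M with
  | zero =>
    have := (projective_iff_hasProjectiveDimensionLE_zero M).2 hM
    exact nonempty_finiteResolution_of_projective M
  | succ n ih =>
    let S := ShortComplex.mk (kernel.ι (Projective.π M)) (Projective.π M) (kernel.condition _)
    have hS : S.ShortExact :=
      { exact := ShortComplex.exact_kernel _
        mono_f := inferInstanceAs (Mono (kernel.ι _))
        epi_g := inferInstanceAs (Epi (Projective.π M)) }
    have hP : Projective S.X₂ := Projective.projective_over M
    obtain ⟨Q⟩ := ih S.X₁ ((hS.hasProjectiveDimensionLT_X₃_iff n hP).1 hM)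
    exact nonempty_finiteResolution_of_shortExact hS Q

end Resolutions

end BridgelandHall

end

open CategoryTheory BridgelandHall in
theorem proposition3p6 {k : Type*} [Field k] [Finite k]
    {𝒜 : Type*} [Category 𝒜] [Abelian 𝒜] [Linear k 𝒜] [EnoughProjectives 𝒜]
    (hgl : HasFiniteGlobalDimension 𝒜) (hfin : IsFinitary k 𝒜) :
    (∀ M : 𝒜, Nonempty (FiniteResolution M)) ∧
    ∀ R : ∀ M : 𝒜, FiniteResolution M,
      Function.Injective (phi k R) ∧
      LinearIndependent ℂ (fun c : IsoClass 𝒜 => (R c.out).elemE k) := by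
  have := hfin.finite_homs
  obtain ⟨d, hd⟩ := id hgl
  refine ⟨fun M => nonempty_finiteResolution_of_hasProjectiveDimensionLE d M (hd M), fun R => ?_⟩
  have h := linearIndependent_elemE k hgl R fun M => nonempty_homology_foldedComplex_iso (R M)
  exact ⟨phi_injective k h, h⟩
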